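/- Let $m$ be Lebesgue measure on $(0,\infty)$ and let $S$ be the space of real measurable, a.e. finite functions on $(0,\infty)$, modulo a.e. equality. For $x\in S$ put $x^*(t)=\inf\{\tau\ge 0: m\{|x|>\tau\}\le t\}$, $t>0$; functions $x,y$ are equimeasurable if $m\{|x|>\tau\}=m\{|y|>\tau\}$ for all $\tau>0$. A rearrangement invariant (r.i.) space $X$ on $(0,\infty)$ is a nonzero Banach space $X\subset S$ such that ($x\in X$, $y\in S$, $|y|\le|x|$ a.e.) implies $y\in X$, $\|y\|_X\le\|x\|_X$, and ($y\in X$, $x\in S$, $x^*\le y^*$) implies $x\in X$, $\|x\|_X\le\|y\|_X$. Its fundamental function is $\phi_X(t)=\|\chi_A\|_X$, where $m(A)=t$. For a positive function $\psi$ on $(0,\infty)$ put $$M_\psi(t)=\sup_{s>0}\frac{\psi(ts)}{\psi(s)},\quad M^0_\psi(t)=\sup_{0<s\le\min(1,1/t)}\frac{\psi(ts)}{\psi(s)},\quad M^\infty_\psi(t)=\sup_{s\ge\max(1,1/t)}\frac{\psi(ts)}{\psi(s)},$$ $$\mu_\psi=-\lim_{n\to\infty}\tfrac1n\log_2M_\psi(2^{-n}),\quad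 \nu_\psi=\lim_{n\to\infty}\tfrac1n\log_2M_\psi(2^{n}),$$ $$\nu^0_\psi=\lim_{n\to\infty}\tfrac1n\log_2M^0_\psi(2^{n}),\quad \mu^\infty_\psi=-\lim_{n\to\infty}\tfrac1n\log_2M^\infty_\psi(2^{-n}).$$ For $1\le p\le\infty$, $\ell^p$ is said to be symmetrically block finitely represented in a sequence $\{z_i\}_{i\ge1}\subset X$ if for all $n\in\mathbb N$ and $\varepsilon>0$ there are integers $0=m_0<m_1<\dots<m_n$ and reals $\alpha_i$ such that the blocks $u_k=\sum_{i=m_{k-1}+1}^{m_k}\alpha_iz_i$, $k=1,\dots,n$, have pairwise disjoint supports, are equimeasurable, and satisfy $$(1+\varepsilon)^{-1}\|a\|_p\le\Big\|\sum_{k=1}^na_ku_k\Big\|_X\le(1+\varepsilon)\|a\|_p\qquad\text{for all }a=(a_k)_{k=1}^n\in\mathbb R^n.$$ Theorem. Let $X$ be a separable r.i. space on $(0,\infty)$ with fundamental function $\phi_X$, and let $\Delta_n^k=[2^{-n}(k-1),2^{-n}k)$, $n=0,1,\dots$, $k=1,2,\dots$. Let the countable family $\{\chi_{\Delta_n^k}\}_{n,k}$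 be arranged into a sequence by an arbitrary bijective enumeration of the pairs $(n,k)$. Then, with the convention $1/0=\infty$: (i) if $\mu^\infty_{\phi_X}\le\nu^0_{\phi_X}$, then $\ell^p$ is symmetrically block finitely represented in this sequence for every $p\in[1/\nu_{\phi_X},1/\mu_{\phi_X}]$; (ii) if $\mu^\infty_{\phi_X}>\nu^0_{\phi_X}$, then $\ell^p$ is symmetrically block finitely represented in this sequence for every $p\in[1/\nu_{\phi_X},1/\mu^\infty_{\phi_X}]\cup[1/\nu^0_{\phi_X},1/\mu_{\phi_X}]$. -/

import Mathlib

open MeasureTheory Filter Topology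

noncomputable section

namespace RISpaces

/-- Lebesgue measure on the half-line `(0, ∞)`. -/
abbrev mPos : Measure ℝ := volume.restrict (Set.Ioi 0)

/-- `S(0, ∞)`: the space of a.e. finite real measurable functions on `(0, ∞)`, modulo equality
almost everywhere. -/
abbrev S : Type := ℝ →ₘ[mPos] ℝ

/-- The characteristic function of a measurable set, as an element of `S`. -/
def charFn (A : Set ℝ) (hA : MeasurableSet A) : S :=
  AEEqFun.mk (A.indicator fun _ => (1 : ℝ))
    (stronglyMeasurable_const.indicator hA).aestronglyMeasurable

/-- The distribution function `τ ↦ m {s > 0 : |x(s)| > τ}`. -/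
def distrib (x : S) (τ : ℝ) : ENNReal := mPos {s | τ < |x s|}

/-- Equimeasurability: `m {|x| > τ} = m {|y| > τ}` for all `τ > 0`. -/
def Equimeasurable (x y : S) : Prop := ∀ τ : ℝ, 0 < τ → distrib x τ = distrib y τ

/-- The nonincreasing rearrangement
`x*(t) = inf {τ ≥ 0 : m {|x| > τ} ≤ t}`, with the usual convention `inf ∅ = ∞`. -/
def rearrangement (x : S) (t : ℝ) : ENNReal :=
  ⨅ (τ : ℝ) (_ : 0 ≤ τ ∧ distrib x τ ≤ ENNReal.ofReal t), ENNReal.ofReal τ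

/-- Disjointness of the supports (up to null sets). -/
def DisjointSupp (x y : S) : Prop := ∀ᵐ s ∂mPos, x s = 0 ∨ y s = 0

section Spaces

variable {E : Type*} [NormedAddCommGroup E] [NormedSpace ℝ E]

/-- `E`, viewed as a linear subspace of `S` through the injection `ι`, is a Banach function lattice
(ideal space): it is complete, and if `x ∈ E`, `y ∈ S`, `|y| ≤ |x|` a.e., then `y ∈ E` and
`‖y‖ ≤ ‖x‖`. -/
structure IsBanachFunctionLattice (ι : E →ₗ[ℝ] S) : Prop where
  complete : CompleteSpace E
  injective : Function.Injective ι
  ideal : ∀ (x : E) (y : S), |y| ≤ |ι x| → ∃ u : E, ι u = y ∧ ‖u‖ ≤ ‖x‖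

/-- A nonzero Banach function lattice on `(0, ∞)` is rearrangement invariant if `y ∈ E`, `x ∈ S`
and `x* ≤ y*` on `(0, ∞)` imply `x ∈ E` and `‖x‖ ≤ ‖y‖`. -/
structure IsRISpace (ι : E →ₗ[ℝ] S) : Prop extends IsBanachFunctionLattice ι where
  nontrivial : Nontrivial E
  symmetric : ∀ (y : E) (x : S), (∀ t : ℝ, 0 < t → rearrangement x t ≤ rearrangement (ι y) t) →
    ∃ u : E, ι u = x ∧ ‖u‖ ≤ ‖y‖

/-- The norm of the space `E ⊆ S` as an extended-valued function on `S`
(it is `∞` outside `E`). -/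
def extNorm (ι : E →ₗ[ℝ] S) (f : S) : ENNReal := ⨅ (u : E) (_ : ι u = f), ‖u‖ₑ

/-- The fundamental function `φ(t) = ‖χ_A‖`, `m(A) = t`; in an r.i. space the value does not depend
on the choice of `A`, and we take `A = (0, t)`. -/
def fundamentalFunction (ι : E →ₗ[ℝ] S) (t : ℝ) : ℝ :=
  (extNorm ι (charFn (Set.Ioo 0 t) measurableSet_Ioo)).toReal

/-- `ℓ^p` is symmetrically block finitely represented in the sequence `z` of elements of the space
`E ⊆ S`: for all `n` and `ε > 0` there are `n` successive blocks `u₁, …, uₙ` of `z` which are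
pairwise disjoint and equimeasurable and are `(1 + ε)`-equivalent to the unit vector basis of
`ℓ^p_n`. (The sequence `z` is indexed from `0`, so the block `u_k` runs over
`m_{k-1} ≤ i < m_k`.) -/
def SymmetricallyBlockFinitelyRepresented (ι : E →ₗ[ℝ] S) (p : ENNReal) (z : ℕ → S) : Prop :=
  ∀ (n : ℕ) (ε : ℝ), 0 < ε →
    ∃ (m : Fin (n + 1) → ℕ) (α : ℕ → ℝ) (u : Fin n → E),
      m 0 = 0 ∧ StrictMono m ∧
      (∀ k : Fin n, ι (u k) = ∑ i ∈ Finset.Ico (m k.castSucc) (m k.succ), α i • z i) ∧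
      (∀ j k : Fin n, j ≠ k → DisjointSupp (ι (u j)) (ι (u k))) ∧
      (∀ j k : Fin n, Equimeasurable (ι (u j)) (ι (u k))) ∧
      ∀ a : Fin n → ℝ,
        (1 + ε)⁻¹ * ‖WithLp.toLp p a‖ ≤ ‖∑ k, a k • u k‖ ∧
        ‖∑ k, a k • u k‖ ≤ (1 + ε) * ‖WithLp.toLp p a‖

end Spaces

/-- The characteristic function of the dyadic interval
`Δ_n^{k+1} = [2^{-n} k, 2^{-n} (k + 1))`, `n, k = 0, 1, 2, …`. -/
def dyadicChar (n k : ℕ) : S :=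
  charFn (Set.Ico ((k : ℝ) / 2 ^ n) (((k : ℝ) + 1) / 2 ^ n)) measurableSet_Ico

/-- The dilation function `M_ψ(t) = sup_{s > 0} ψ(ts) / ψ(s)`. -/
def dil (ψ : ℝ → ℝ) (t : ℝ) : ℝ := ⨆ s : Set.Ioi (0 : ℝ), ψ (t * s) / ψ s

/-- The dilation function `M_ψ^0(t) = sup_{0 < s ≤ min(1, 1/t)} ψ(ts) / ψ(s)`. -/
def dilZero (ψ : ℝ → ℝ) (t : ℝ) : ℝ := ⨆ s : Set.Ioc (0 : ℝ) (min 1 (1 / t)), ψ (t * s) / ψ s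

/-- The dilation function `M_ψ^∞(t) = sup_{s ≥ max(1, 1/t)} ψ(ts) / ψ(s)`. -/
def dilInfty (ψ : ℝ → ℝ) (t : ℝ) : ℝ := ⨆ s : Set.Ici (max (1 : ℝ) (1 / t)), ψ (t * s) / ψ s

/-- `- lim_{n → ∞} (1/n) log₂ M(2^{-n})`. -/
def lowerIndex (M : ℝ → ℝ) : ℝ :=
  -limUnder atTop fun n : ℕ => (1 / (n : ℝ)) * Real.logb 2 (M ((2 : ℝ) ^ (-(n : ℤ))))

/-- `lim_{n → ∞} (1/n) log₂ M(2^n)`. -/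
def upperIndex (M : ℝ → ℝ) : ℝ :=
  limUnder atTop fun n : ℕ => (1 / (n : ℝ)) * Real.logb 2 (M ((2 : ℝ) ^ n))

/-- The dilation index `μ_ψ`. -/
def muIndex (ψ : ℝ → ℝ) : ℝ := lowerIndex (dil ψ)

/-- The dilation index `ν_ψ`. -/
def nuIndex (ψ : ℝ → ℝ) : ℝ := upperIndex (dil ψ)

/-- The dilation index `ν_ψ^0`. -/
def nuZeroIndex (ψ : ℝ → ℝ) : ℝ := upperIndex (dilZero ψ)

/-- The dilation index `μ_ψ^∞`. -/
def muInftyIndex (ψ : ℝ → ℝ) : ℝ := lowerIndex (dilInfty ψ)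

/-- The reciprocal `1/r ∈ [0, ∞]` of a number `r ≥ 0`, with `1/0 = ∞`. -/
def recip (r : ℝ) : ENNReal := (ENNReal.ofReal r)⁻¹

end RISpaces

end

/-!
Write `θ = 1 / p`. Suppose that `t ^ (-θ) * φ t` has *damped peaks*: points `c` where it is much
larger than at some `a < c` and some `b > c`, even after the latter values have been weighted by
small powers `(a / c) ^ e`, `(c / b) ^ e`. Integrating the hat-shaped weight
`min ((s / c) ^ e) ((c / s) ^ e) * s ^ (-θ - 1)` from `t ∨ a` to `b` gives a nonincreasing function
`F` with `F (t / N) ≈ N ^ θ * F t` for `N` in a compact subset of `(0, 1]`: the errors are a small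
multiple of `F` and multiples of `χ_(0, a)`, `χ_(0, b)`, which are negligible in norm because the
weight is damped at `a` and `b`. Disjoint copies of the dilates `F (· / N k)` with `∑ N k = 1` are
together equimeasurable with `F`, so disjoint translates `F k` of `F` satisfy
`‖∑ N k ^ θ • F k‖ ≈ ‖F‖`, which is the behaviour of the unit vectors of `ℓ^p`. Approximating `F`
by a dyadic step function and refining the dyadic grid produces disjoint blocks lying arbitrarily
far in any enumeration of the dyadic intervals.

If there are no damped peaks, then each point sees a power decay from the left or a power growth to
the right, and a decaying point can lie only a bounded factor to the right of a growing one. Hence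
either all points are of one kind, or all sufficiently small ones decay and all sufficiently large
ones grow; this pushes `θ` out of the intervals between the dilation indices.
-/

noncomputable section

namespace RISpaces

lemma ae_mPos_pos : ∀ᵐ s ∂mPos, 0 < s :=
  ae_restrict_mem measurableSet_Ioi

/-- The distribution function `τ ↦ m {s > 0 : |f(s)| > τ}` of a function on `ℝ`: the analogue of
`distrib` for functions in place of their classes. -/
def distribution (f : ℝ → ℝ) (τ : ℝ) : ENNReal := mPos {s | τ < |f s|}

lemma distribution_congr {f g : ℝ → ℝ} (h : f =ᵐ[mPos] g) (τ : ℝ) :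
    distribution f τ = distribution g τ := by
  apply measure_congr
  filter_upwards [h] with s hs
  change (τ < |f s|) = (τ < |g s|)
  rw [hs]

lemma distribution_mono {f g : ℝ → ℝ} (h : ∀ s, 0 < s → |f s| ≤ |g s|) (τ : ℝ) :
    distribution f τ ≤ distribution g τ := by
  apply measure_mono_ae
  filter_upwards [ae_mPos_pos] with s hs hτ
  exact hτ.trans_le (h s hs)

lemma distrib_eq_distribution {x : S} {f : ℝ → ℝ} (h : x =ᵐ[mPos] f) (τ : ℝ) :
    distrib x τ = distribution f τ :=
  distribution_congr h τ

lemma rearrangement_le_of_distrib_le {x y : S} (h : ∀ τ, 0 ≤ τ → distrib x τ ≤ distrib y τ)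
    (t : ℝ) : rearrangement x t ≤ rearrangement y t :=
  le_iInf₂ fun τ hτ => iInf₂_le_of_le τ ⟨hτ.1, (h τ hτ.1).trans hτ.2⟩ le_rfl

lemma distribution_eq_volume {f : ℝ → ℝ} (hf : Function.support f ⊆ Set.Ici 0) {τ : ℝ}
    (hτ : 0 ≤ τ) : distribution f τ = volume {s | τ < |f s|} := by
  have hs : {s | τ < |f s|} ⊆ Set.Ici 0 :=
    fun s hs => hf (abs_pos.1 (hτ.trans_lt hs))
  rw [distribution, mPos, Measure.restrict_congr_set Ioi_ae_eq_Ici, Measure.restrict_eq_self _ hs]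

lemma distribution_shift {f : ℝ → ℝ} (hf : Function.support f ⊆ Set.Ici 0) {d τ : ℝ} (hd : 0 ≤ d)
    (hτ : 0 ≤ τ) : distribution (fun t => f (t - d)) τ = distribution f τ := by
  have hshift : Function.support (fun t => f (t - d)) ⊆ Set.Ici 0 :=
    fun t ht => hd.trans (sub_nonneg.1 (hf ht))
  rw [distribution_eq_volume hf hτ, distribution_eq_volume hshift hτ]
  simp only [sub_eq_add_neg]
  exact measure_preimage_add_right volume (-d) {s | τ < |f s|}

lemma distribution_dilate {f : ℝ → ℝ} (hf : Function.support f ⊆ Set.Ioi 0) {N τ : ℝ} (hN : 0 ≤ N)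
    (hτ : 0 ≤ τ) : distribution (fun t => f (t / N)) τ = ENNReal.ofReal N * distribution f τ := by
  rcases hN.eq_or_lt with rfl | hN
  · have h0 : f 0 = 0 := Function.notMem_support.1 fun h => Set.self_notMem_Ioi (hf h)
    simp [distribution, h0, hτ.not_gt]
  have hdilate : Function.support (fun t => f (t / N)) ⊆ Set.Ici 0 :=
    fun t ht => ((div_pos_iff_of_pos_right hN).1 (hf ht)).le
  rw [distribution_eq_volume (hf.trans Set.Ioi_subset_Ici_self) hτ,
    distribution_eq_volume hdilate hτ]
  simpa [div_eq_mul_inv, abs_of_pos hN] using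
    Real.volume_preimage_mul_right (inv_ne_zero hN.ne') {s | τ < |f s|}

/-- The indicator function of `(0, t)`. -/
def chi (t : ℝ) : ℝ → ℝ := (Set.Ioo 0 t).indicator fun _ => 1

lemma chi_of_mem {t s : ℝ} (h : s ∈ Set.Ioo 0 t) : chi t s = 1 :=
  Set.indicator_of_mem h _

lemma chi_nonneg (t s : ℝ) : 0 ≤ chi t s :=
  Set.indicator_nonneg (fun _ _ => zero_le_one) s

lemma chi_le_one (t s : ℝ) : chi t s ≤ 1 :=
  Set.indicator_le_self' (fun _ _ => zero_le_one) s

lemma chi_mono {r t : ℝ} (h : r ≤ t) (s : ℝ) : chi r s ≤ chi t s :=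
  Set.indicator_le_indicator_of_subset (Set.Ioo_subset_Ioo_right h) (fun _ => zero_le_one) s

lemma support_chi_subset (t : ℝ) : Function.support (chi t) ⊆ Set.Ioo 0 t :=
  Set.support_indicator_subset

lemma chi_two_mul_ae (t : ℝ) : chi (2 * t) =ᵐ[mPos] chi t + fun s => chi t (s - t) := by
  have hne : ∀ᵐ s ∂mPos, s ≠ t := compl_mem_ae_iff.2 (measure_singleton t)
  filter_upwards [hne, ae_mPos_pos] with s hs h0
  rcases lt_or_gt_of_ne hs with h | h
  · simp [chi, h0, h, h.le, show s < 2 * t by linarith]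
  · simp [chi, h0, h, h.le, sub_lt_iff_lt_add, two_mul, Set.indicator_apply]

lemma distribution_chi_of_lt {t τ : ℝ} (h0 : 0 ≤ τ) (h : τ < 1) :
    distribution (chi t) τ = ENNReal.ofReal t := by
  rw [distribution_eq_volume (fun s hs => (support_chi_subset t hs).1.le) h0]
  have hset : {s | τ < |chi t s|} = Set.Ioo 0 t := by
    ext s
    by_cases hs : s ∈ Set.Ioo 0 t
    · simpa only [Set.mem_ofPred_eq, chi_of_mem hs, abs_one, hs, iff_true] using h
    · simpa only [Set.mem_ofPred_eq, chi, Set.indicator_of_notMem hs, abs_zero, hs, iff_false,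
        not_lt] using h0
  rw [hset, Real.volume_Ioo, sub_zero]

lemma distribution_chi_of_one_le {t τ : ℝ} (h : 1 ≤ τ) : distribution (chi t) τ = 0 := by
  have hempty : {s | τ < |chi t s|} = ∅ := by
    ext s
    simpa only [Set.mem_ofPred_eq, Set.mem_empty_iff_false, iff_false, not_lt,
      abs_of_nonneg (chi_nonneg t s)] using (chi_le_one t s).trans h
  rw [distribution, hempty, measure_empty]

lemma exists_ofReal_le_distribution {f : ℝ → ℝ} (hf : ¬ f =ᵐ[mPos] 0) :
    ∃ δ > 0, ∃ t > 0, ENNReal.ofReal t ≤ distribution f δ := by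
  have hpos : ∃ n : ℕ, distribution f (1 / ((n : ℝ) + 1)) ≠ 0 := by
    by_contra! hnull
    have hsmall : ∀ᵐ s ∂mPos, ∀ n : ℕ, |f s| ≤ 1 / ((n : ℝ) + 1) :=
      ae_all_iff.2 fun n => by simpa only [ae_iff, not_le, distribution] using hnull n
    refine hf (hsmall.mono fun s hs => by_contra fun hne => ?_)
    obtain ⟨n, hn⟩ := exists_nat_one_div_lt (abs_pos.2 hne)
    exact (hs n).not_gt hn
  obtain ⟨n, hn⟩ := hpos
  obtain ⟨r, hr0, hr⟩ := ENNReal.lt_iff_exists_nnreal_btwn.1 (pos_iff_ne_zero.2 hn)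
  exact ⟨1 / (n + 1), Nat.one_div_pos_of_nat, r, by exact_mod_cast hr0, by simpa using hr.le⟩

/-- Bounded measurable functions on `ℝ` with bounded support in `[0, ∞)`. They represent elements of
every r.i. space, and are all that the construction needs. -/
structure BddSupp (f : ℝ → ℝ) : Prop where
  measurable : Measurable f
  bounded : ∃ C, ∀ t, |f t| ≤ C
  support_subset : ∃ B, Function.support f ⊆ Set.Ico 0 B

namespace BddSupp

variable {f g : ℝ → ℝ}

lemma support_subset_Ici (hf : BddSupp f) : Function.support f ⊆ Set.Ici 0 :=
  let ⟨_, hB⟩ := hf.support_subset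
  hB.trans Set.Ico_subset_Ici_self

lemma zero : BddSupp 0 :=
  ⟨measurable_const, ⟨0, by simp⟩, ⟨0, by simp⟩⟩

lemma add (hf : BddSupp f) (hg : BddSupp g) : BddSupp (f + g) := by
  obtain ⟨C, hC⟩ := hf.bounded
  obtain ⟨D, hD⟩ := hg.bounded
  obtain ⟨A, hA⟩ := hf.support_subset
  obtain ⟨B, hB⟩ := hg.support_subset
  refine ⟨hf.measurable.add hg.measurable,
    ⟨C + D, fun t => (abs_add_le _ _).trans (add_le_add (hC t) (hD t))⟩, max A B, ?_⟩
  refine (Function.support_add f g).trans (Set.union_subset ?_ ?_)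
  · exact hA.trans (Set.Ico_subset_Ico_right (le_max_left _ _))
  · exact hB.trans (Set.Ico_subset_Ico_right (le_max_right _ _))

lemma const_smul (hf : BddSupp f) (c : ℝ) : BddSupp (c • f) := by
  obtain ⟨C, hC⟩ := hf.bounded
  obtain ⟨A, hA⟩ := hf.support_subset
  refine ⟨hf.measurable.const_smul c, ⟨|c| * C, fun t => ?_⟩, A,
    (Function.support_const_smul_subset c f).trans hA⟩
  rw [Pi.smul_apply, smul_eq_mul, abs_mul]
  exact mul_le_mul_of_nonneg_left (hC t) (abs_nonneg c)

lemma sub (hf : BddSupp f) (hg : BddSupp g) : BddSupp (f - g) := by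
  simpa only [neg_one_smul, ← sub_eq_add_neg] using hf.add (hg.const_smul (-1))

lemma sum {κ : Type*} (s : Finset κ) {f : κ → ℝ → ℝ} (hf : ∀ k ∈ s, BddSupp (f k)) :
    BddSupp (∑ k ∈ s, f k) :=
  Finset.sum_induction f BddSupp (fun _ _ => add) zero hf

lemma chi (t : ℝ) : BddSupp (chi t) :=
  ⟨measurable_const.indicator measurableSet_Ioo,
    ⟨1, fun s => (abs_of_nonneg (chi_nonneg t s)).trans_le (chi_le_one t s)⟩,
    t, (support_chi_subset t).trans Set.Ioo_subset_Ico_self⟩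

lemma shift (hf : BddSupp f) {d : ℝ} (hd : 0 ≤ d) : BddSupp (fun t => f (t - d)) := by
  obtain ⟨C, hC⟩ := hf.bounded
  obtain ⟨A, hA⟩ := hf.support_subset
  exact ⟨hf.measurable.comp (measurable_id.sub_const d), ⟨C, fun t => hC _⟩, A + d,
    fun t ht => ⟨hd.trans (sub_nonneg.1 (hA ht).1), sub_lt_iff_lt_add.1 (hA ht).2⟩⟩

lemma dilate (hf : BddSupp f) (h0 : f 0 = 0) {N : ℝ} (hN : 0 ≤ N) :
    BddSupp (fun t => f (t / N)) := by
  obtain ⟨C, hC⟩ := hf.bounded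
  obtain ⟨A, hA⟩ := hf.support_subset
  rcases hN.eq_or_lt with rfl | hN
  · simp only [div_zero, h0]
    exact zero
  refine ⟨hf.measurable.comp (measurable_id.div_const N), ⟨C, fun t => hC _⟩, A * N,
    fun t ht => ⟨?_, (div_lt_iff₀ hN).1 (hA ht).2⟩⟩
  simpa only [zero_mul] using (le_div_iff₀ hN).1 (hA ht).1

end BddSupp

section Representatives

variable {E : Type*} [AddCommGroup E] [Module ℝ E] {ι : E →ₗ[ℝ] S}

lemma repr_zero (ι : E →ₗ[ℝ] S) : ι 0 =ᵐ[mPos] 0 := by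
  rw [map_zero]
  exact AEEqFun.coeFn_zero

lemma repr_add {u v : E} {f g : ℝ → ℝ} (hf : ι u =ᵐ[mPos] f) (hg : ι v =ᵐ[mPos] g) :
    ι (u + v) =ᵐ[mPos] f + g := by
  rw [map_add]
  exact (AEEqFun.coeFn_add _ _).trans (hf.add hg)

lemma repr_smul {u : E} {f : ℝ → ℝ} (hf : ι u =ᵐ[mPos] f) (c : ℝ) :
    ι (c • u) =ᵐ[mPos] c • f := by
  rw [map_smul]
  exact (AEEqFun.coeFn_smul _ _).trans (hf.const_smul c)

lemma repr_sum {κ : Type*} (s : Finset κ) {u : κ → E} {f : κ → ℝ → ℝ}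
    (h : ∀ k ∈ s, ι (u k) =ᵐ[mPos] f k) : ι (∑ k ∈ s, u k) =ᵐ[mPos] ∑ k ∈ s, f k := by
  classical
  induction s using Finset.induction_on with
  | empty => exact repr_zero ι
  | insert a s ha ih =>
    rw [Finset.sum_insert ha, Finset.sum_insert ha]
    exact repr_add (h a (Finset.mem_insert_self _ _))
      (ih fun k hk => h k (Finset.mem_insert_of_mem hk))

end Representatives

section FnNorm

variable {E : Type*} [NormedAddCommGroup E] [NormedSpace ℝ E] {ι : E →ₗ[ℝ] S}

namespace IsRISpace

lemma exists_repr_of_distribution_le (hι : IsRISpace ι) {u : E} {f g : ℝ → ℝ} (hf : Measurable f)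
    (hg : ι u =ᵐ[mPos] g) (h : ∀ τ, 0 ≤ τ → distribution f τ ≤ distribution g τ) :
    ∃ v : E, ι v =ᵐ[mPos] f ∧ ‖v‖ ≤ ‖u‖ := by
  have hmk := AEEqFun.coeFn_mk (μ := mPos) f hf.aestronglyMeasurable
  obtain ⟨v, hv, hn⟩ := hι.symmetric u (AEEqFun.mk f hf.aestronglyMeasurable)
    fun t _ => rearrangement_le_of_distrib_le (fun τ hτ => by
      rw [distrib_eq_distribution hmk, distrib_eq_distribution hg]
      exact h τ hτ) t
  exact ⟨v, hv ▸ hmk, hn⟩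

lemma exists_pos_repr_chi (hι : IsRISpace ι) : ∃ t > 0, ∃ u : E, ι u =ᵐ[mPos] chi t := by
  obtain ⟨x, hx⟩ := @exists_ne E hι.nontrivial 0
  have hx0 : ¬ ι x =ᵐ[mPos] 0 :=
    fun h => hx (hι.injective (AEEqFun.ext (h.trans (repr_zero ι).symm)))
  obtain ⟨δ, hδ, t, ht, hle⟩ := exists_ofReal_le_distribution hx0
  obtain ⟨v, hv, -⟩ := hι.exists_repr_of_distribution_le (BddSupp.chi t).measurable
    (repr_smul (EventuallyEq.refl _ (ι x : ℝ → ℝ)) δ⁻¹) (fun τ hτ => by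
      rcases lt_or_ge τ 1 with h1 | h1
      · rw [distribution_chi_of_lt hτ h1]
        refine hle.trans (measure_mono fun s (hs : δ < |ι x s|) => h1.trans ?_)
        rwa [Pi.smul_apply, smul_eq_mul, abs_mul, abs_of_pos (inv_pos.2 hδ), ← div_eq_inv_mul,
          one_lt_div hδ]
      · rw [distribution_chi_of_one_le h1]
        exact zero_le)
  exact ⟨t, ht, v, hv⟩

lemma exists_repr_chi (hι : IsRISpace ι) (t : ℝ) : ∃ u : E, ι u =ᵐ[mPos] chi t := by
  obtain ⟨t₀, ht₀, u₀, hu₀⟩ := hι.exists_pos_repr_chi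
  have hdyadic : ∀ n : ℕ, ∃ u : E, ι u =ᵐ[mPos] chi (2 ^ n * t₀) := by
    intro n
    induction n with
    | zero => exact ⟨u₀, by simpa only [pow_zero, one_mul] using hu₀⟩
    | succ n ih =>
      obtain ⟨u, hu⟩ := ih
      have hchi := BddSupp.chi (2 ^ n * t₀)
      have hpos : 0 ≤ 2 ^ n * t₀ := by positivity
      obtain ⟨v, hv, -⟩ := hι.exists_repr_of_distribution_le (hchi.shift hpos).measurable hu
        fun τ hτ => (distribution_shift hchi.support_subset_Ici hpos hτ).le
      refine ⟨u + v, (repr_add hu hv).trans ?_⟩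
      rw [pow_succ', mul_assoc]
      exact (chi_two_mul_ae _).symm
  obtain ⟨n, hn⟩ := pow_unbounded_of_one_lt (t / t₀) one_lt_two
  obtain ⟨u, hu⟩ := hdyadic n
  have hle : t ≤ 2 ^ n * t₀ := ((div_lt_iff₀ ht₀).1 hn).le
  obtain ⟨v, hv, -⟩ := hι.exists_repr_of_distribution_le (BddSupp.chi t).measurable hu
    fun τ _ => distribution_mono (fun s _ => abs_le_abs_of_nonneg (chi_nonneg _ _)
      (chi_mono hle s)) τ
  exact ⟨v, hv⟩

lemma exists_repr (hι : IsRISpace ι) {f : ℝ → ℝ} (hf : BddSupp f) :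
    ∃ u : E, ι u =ᵐ[mPos] f := by
  obtain ⟨C, hC⟩ := hf.bounded
  obtain ⟨B, hB⟩ := hf.support_subset
  obtain ⟨u, hu⟩ := hι.exists_repr_chi B
  have hle : ∀ s, 0 < s → |f s| ≤ |(C • chi B) s| := by
    intro s hs
    by_cases hsB : s < B
    · rw [Pi.smul_apply, chi_of_mem ⟨hs, hsB⟩, smul_eq_mul, mul_one]
      exact (hC s).trans (le_abs_self C)
    · rw [Function.notMem_support.1 fun h => hsB (hB h).2, abs_zero]
      exact abs_nonneg _
  obtain ⟨v, hv, -⟩ := hι.exists_repr_of_distribution_le hf.measurable (repr_smul hu C)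
    fun τ _ => distribution_mono hle τ
  exact ⟨v, hv⟩

end IsRISpace

/-- The norm of the space `E ⊆ S` evaluated on a function on `ℝ`: the analogue of `extNorm` for
functions in place of their classes, made real-valued. It is `0` outside of the space. -/
def fnNorm (ι : E →ₗ[ℝ] S) (f : ℝ → ℝ) : ℝ :=
  (⨅ (u : E) (_ : ι u =ᵐ[mPos] f), ‖u‖ₑ).toReal

lemma fnNorm_nonneg (ι : E →ₗ[ℝ] S) (f : ℝ → ℝ) : 0 ≤ fnNorm ι f :=
  ENNReal.toReal_nonneg

lemma fundamentalFunction_eq_fnNorm_chi (ι : E →ₗ[ℝ] S) (t : ℝ) :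
    fundamentalFunction ι t = fnNorm ι (chi t) := by
  have hiff (u : E) : ι u = charFn (Set.Ioo 0 t) measurableSet_Ioo ↔ ι u =ᵐ[mPos] chi t := by
    rw [AEEqFun.ext_iff]
    have hmk : charFn (Set.Ioo 0 t) measurableSet_Ioo =ᵐ[mPos] chi t := AEEqFun.coeFn_mk _ _
    exact ⟨fun h => h.trans hmk, fun h => h.trans hmk.symm⟩
  simp only [fundamentalFunction, extNorm, hiff, fnNorm]

namespace IsRISpace

variable {f g : ℝ → ℝ}

lemma fnNorm_eq (hι : IsRISpace ι) {u : E} (h : ι u =ᵐ[mPos] f) : fnNorm ι f = ‖u‖ := by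
  have hinf : ⨅ (v : E) (_ : ι v =ᵐ[mPos] f), ‖v‖ₑ = ‖u‖ₑ := by
    refine le_antisymm (iInf₂_le_of_le u h le_rfl) (le_iInf₂ fun v hv => ?_)
    rw [hι.injective (AEEqFun.ext (hv.trans h.symm))]
  rw [fnNorm, hinf, toReal_enorm]

lemma fnNorm_le_of_distribution_le (hι : IsRISpace ι) (hf : BddSupp f) (hg : BddSupp g)
    (h : ∀ τ, 0 ≤ τ → distribution f τ ≤ distribution g τ) : fnNorm ι f ≤ fnNorm ι g := by
  obtain ⟨u, hu⟩ := hι.exists_repr hg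
  obtain ⟨v, hv, hn⟩ := hι.exists_repr_of_distribution_le hf.measurable hu h
  rwa [hι.fnNorm_eq hu, hι.fnNorm_eq hv]

lemma fnNorm_eq_of_distribution_eq (hι : IsRISpace ι) (hf : BddSupp f) (hg : BddSupp g)
    (h : ∀ τ, 0 ≤ τ → distribution f τ = distribution g τ) : fnNorm ι f = fnNorm ι g :=
  le_antisymm (hι.fnNorm_le_of_distribution_le hf hg fun τ hτ => (h τ hτ).le)
    (hι.fnNorm_le_of_distribution_le hg hf fun τ hτ => (h τ hτ).ge)

lemma fnNorm_mono (hι : IsRISpace ι) (hf : BddSupp f) (hg : BddSupp g)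
    (h : ∀ t, 0 < t → |f t| ≤ |g t|) : fnNorm ι f ≤ fnNorm ι g :=
  hι.fnNorm_le_of_distribution_le hf hg fun τ _ => distribution_mono h τ

lemma fnNorm_mono_of_nonneg (hι : IsRISpace ι) (hf : BddSupp f) (hg : BddSupp g)
    (h0 : ∀ t, 0 ≤ f t) (h : ∀ t, 0 < t → f t ≤ g t) : fnNorm ι f ≤ fnNorm ι g :=
  hι.fnNorm_mono hf hg fun t ht => abs_le_abs_of_nonneg (h0 t) (h t ht)

lemma fnNorm_add_le (hι : IsRISpace ι) (hf : BddSupp f) (hg : BddSupp g) :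
    fnNorm ι (f + g) ≤ fnNorm ι f + fnNorm ι g := by
  obtain ⟨u, hu⟩ := hι.exists_repr hf
  obtain ⟨v, hv⟩ := hι.exists_repr hg
  rw [hι.fnNorm_eq hu, hι.fnNorm_eq hv, hι.fnNorm_eq (repr_add hu hv)]
  exact norm_add_le u v

lemma abs_fnNorm_add_sub_le (hι : IsRISpace ι) (hf : BddSupp f) (hg : BddSupp g) :
    |fnNorm ι (f + g) - fnNorm ι f| ≤ fnNorm ι g := by
  obtain ⟨u, hu⟩ := hι.exists_repr hf
  obtain ⟨v, hv⟩ := hι.exists_repr hg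
  rw [hι.fnNorm_eq hu, hι.fnNorm_eq hv, hι.fnNorm_eq (repr_add hu hv)]
  simpa only [add_sub_cancel_left] using abs_norm_sub_norm_le (u + v) u

lemma fnNorm_const_smul (hι : IsRISpace ι) (hf : BddSupp f) (c : ℝ) :
    fnNorm ι (c • f) = |c| * fnNorm ι f := by
  obtain ⟨u, hu⟩ := hι.exists_repr hf
  rw [hι.fnNorm_eq hu, hι.fnNorm_eq (repr_smul hu c), norm_smul, Real.norm_eq_abs]

lemma fnNorm_sum_le (hι : IsRISpace ι) {κ : Type*} (s : Finset κ) {f : κ → ℝ → ℝ}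
    (hf : ∀ k ∈ s, BddSupp (f k)) : fnNorm ι (∑ k ∈ s, f k) ≤ ∑ k ∈ s, fnNorm ι (f k) := by
  refine Finset.le_sum_of_subadditive_on_pred (fnNorm ι) BddSupp ?_
    (fun _ _ => hι.fnNorm_add_le) (fun _ _ => BddSupp.add) f hf
  rw [hι.fnNorm_eq (repr_zero ι), norm_zero]

lemma fnNorm_shift (hι : IsRISpace ι) (hf : BddSupp f) {d : ℝ} (hd : 0 ≤ d) :
    fnNorm ι (fun t => f (t - d)) = fnNorm ι f :=
  hι.fnNorm_eq_of_distribution_eq (hf.shift hd) hf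
    fun _ => distribution_shift hf.support_subset_Ici hd

lemma fnNorm_chi_mono (hι : IsRISpace ι) {s t : ℝ} (h : s ≤ t) :
    fnNorm ι (chi s) ≤ fnNorm ι (chi t) :=
  hι.fnNorm_mono_of_nonneg (.chi s) (.chi t) (chi_nonneg s) fun x _ => chi_mono h x

lemma fnNorm_chi_two_mul_le (hι : IsRISpace ι) {t : ℝ} (ht : 0 ≤ t) :
    fnNorm ι (chi (2 * t)) ≤ 2 * fnNorm ι (chi t) := by
  have hchi := BddSupp.chi t
  calc fnNorm ι (chi (2 * t)) = fnNorm ι (chi t + fun s => chi t (s - t)) :=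
        hι.fnNorm_eq_of_distribution_eq (.chi _) (hchi.add (hchi.shift ht))
          fun τ _ => distribution_congr (chi_two_mul_ae t) τ
    _ ≤ fnNorm ι (chi t) + fnNorm ι (fun s => chi t (s - t)) :=
        hι.fnNorm_add_le hchi (hchi.shift ht)
    _ = 2 * fnNorm ι (chi t) := by rw [hι.fnNorm_shift hchi ht, two_mul]

lemma fnNorm_chi_pos (hι : IsRISpace ι) {t : ℝ} (ht : 0 < t) : 0 < fnNorm ι (chi t) := by
  obtain ⟨x, hx⟩ := hι.exists_repr_chi t
  rw [hι.fnNorm_eq hx, norm_pos_iff]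
  rintro rfl
  have hdist := distribution_congr ((repr_zero ι).symm.trans hx) 0
  rw [distribution_chi_of_lt le_rfl one_pos] at hdist
  simp [distribution, ht.not_ge] at hdist

end IsRISpace

end FnNorm

/-- Bounded functions with bounded support which vanish on `(-∞, 0]` and are decreasing and
Lipschitz on `(0, ∞)`. -/
structure DecreasingProfile (F : ℝ → ℝ) : Prop where
  bddSupp : BddSupp F
  support_subset : Function.support F ⊆ Set.Ioi 0
  nonneg : ∀ t, 0 ≤ F t
  antitoneOn : AntitoneOn F (Set.Ioi 0)
  lipschitzOn : ∃ K, LipschitzOnWith K F (Set.Ioi 0)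

lemma DecreasingProfile.apply_of_nonpos {F : ℝ → ℝ} (hF : DecreasingProfile F) {t : ℝ}
    (ht : t ≤ 0) : F t = 0 :=
  Function.notMem_support.1 fun h => ht.not_gt (hF.support_subset h)

lemma DecreasingProfile.apply_div_le_apply_div {F : ℝ → ℝ} (hF : DecreasingProfile F) {x y : ℝ}
    (hx : 0 ≤ x) (hxy : x ≤ y) (t : ℝ) : F (t / x) ≤ F (t / y) := by
  have hFy := hF.nonneg (t / y)
  rcases le_or_gt t 0 with ht | ht
  · rwa [hF.apply_of_nonpos (div_nonpos_of_nonpos_of_nonneg ht hx)]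
  rcases hx.eq_or_lt with rfl | hpos
  · rwa [div_zero, hF.apply_of_nonpos le_rfl]
  · exact hF.antitoneOn (div_pos ht (hpos.trans_le hxy)) (div_pos ht hpos)
      (div_le_div_of_nonneg_left ht.le hpos hxy)

/-- The truncated primitive `t ↦ ∫ k` over `(a, b] ∩ (t, ∞)`, extended by zero to `(-∞, 0]`. -/
def primitiveBetween (k : ℝ → ℝ) (a b : ℝ) : ℝ → ℝ :=
  (Set.Ioi 0).indicator fun t => ∫ s in Set.Ioc a b ∩ Set.Ioi t, k s

section Primitive

variable {k : ℝ → ℝ} {a b t : ℝ}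

lemma primitiveBetween_of_pos (ht : 0 < t) :
    primitiveBetween k a b t = ∫ s in Set.Ioc a b ∩ Set.Ioi t, k s :=
  Set.indicator_of_mem ht _

lemma primitiveBetween_of_nonpos (ht : t ≤ 0) : primitiveBetween k a b t = 0 :=
  Set.indicator_of_notMem (Set.notMem_Ioi.2 ht) _

open scoped Pointwise in
lemma setIntegral_eq_setIntegral_dilate (k : ℝ → ℝ) {N : ℝ} (hN : 0 < N) (A : Set ℝ) :
    ∫ s in A, k s = ∫ s in N • A, k (s / N) / N := by
  have h := Measure.setIntegral_comp_smul_of_pos volume (fun s => k (s / N)) A hN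
  simp only [smul_eq_mul, Module.finrank_self, pow_one, mul_div_cancel_left₀ _ hN.ne'] at h
  rw [h, integral_div, inv_mul_eq_div]

lemma primitiveBetween_dilate (k : ℝ → ℝ) {N : ℝ} (hN : 0 < N) (a b t : ℝ) :
    primitiveBetween k a b (t / N) =
      primitiveBetween (fun s => k (s / N) / N) (N * a) (N * b) t := by
  rcases le_or_gt t 0 with ht | ht
  · rw [primitiveBetween_of_nonpos ht,
      primitiveBetween_of_nonpos (div_nonpos_of_nonpos_of_nonneg ht hN.le)]
  rw [primitiveBetween_of_pos (div_pos ht hN), primitiveBetween_of_pos ht,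
    setIntegral_eq_setIntegral_dilate k hN, Set.smul_set_inter₀ hN.ne',
    LinearOrderedField.smul_Ioc hN, LinearOrderedField.smul_Ioi hN,
    mul_div_cancel₀ _ hN.ne']

lemma continuousOn_dilate (hk : ContinuousOn k (Set.Ioi 0)) {N : ℝ} (hN : 0 < N) :
    ContinuousOn (fun s => k (s / N) / N) (Set.Ioi 0) :=
  (hk.comp (continuous_id.div_const N).continuousOn fun _ hs => div_pos hs hN).div_const N

lemma integrableOn_Ioc_of_pos (hk : ContinuousOn k (Set.Ioi 0)) (ha : 0 < a) :
    IntegrableOn k (Set.Ioc a b) :=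
  (hk.mono fun _ hs => ha.trans_le hs.1).integrableOn_Icc.mono_set Set.Ioc_subset_Icc_self

lemma ae_nonneg_restrict_Ioc (hk : ∀ s, 0 < s → 0 ≤ k s) (ha : 0 ≤ a) :
    0 ≤ᵐ[volume.restrict (Set.Ioc a b)] k :=
  (ae_restrict_mem measurableSet_Ioc).mono fun s hs => hk s (ha.trans_lt hs.1)

lemma primitiveBetween_nonneg (hk : ∀ s, 0 < s → 0 ≤ k s) (t : ℝ) :
    0 ≤ primitiveBetween k a b t :=
  Set.indicator_nonneg (fun _ ht => setIntegral_nonneg (measurableSet_Ioc.inter measurableSet_Ioi)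
    fun s hs => hk s (ht.trans hs.2)) t

variable (hk : ContinuousOn k (Set.Ioi 0))

include hk in
lemma primitiveBetween_mono_weight {k' : ℝ → ℝ} (hk' : ContinuousOn k' (Set.Ioi 0))
    (h : ∀ s, 0 < s → k s ≤ k' s) (ha : 0 < a) (t : ℝ) :
    primitiveBetween k a b t ≤ primitiveBetween k' a b t :=
  Set.indicator_le_indicator <| setIntegral_mono_on
    ((integrableOn_Ioc_of_pos hk ha).mono_set Set.inter_subset_left)
    ((integrableOn_Ioc_of_pos hk' ha).mono_set Set.inter_subset_left)
    (measurableSet_Ioc.inter measurableSet_Ioi) fun s hs => h s (ha.trans hs.1.1)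

lemma primitiveBetween_const_mul (k : ℝ → ℝ) (C a b t : ℝ) :
    primitiveBetween (fun s => C * k s) a b t = C * primitiveBetween k a b t := by
  simp only [primitiveBetween, integral_const_mul, Set.indicator_const_mul]

include hk in
lemma primitiveBetween_add {c : ℝ} (ha : 0 < a) (hab : a ≤ b) (hbc : b ≤ c) (t : ℝ) :
    primitiveBetween k a b t + primitiveBetween k b c t = primitiveBetween k a c t := by
  rcases le_or_gt t 0 with ht | ht
  · simp only [primitiveBetween_of_nonpos ht, add_zero]
  have hdisj : Disjoint (Set.Ioc a b ∩ Set.Ioi t) (Set.Ioc b c ∩ Set.Ioi t) :=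
    (Set.Ioc_disjoint_Ioc_of_le le_rfl).mono Set.inter_subset_left Set.inter_subset_left
  simp only [primitiveBetween_of_pos ht]
  rw [← Set.Ioc_union_Ioc_eq_Ioc hab hbc, Set.union_inter_distrib_right,
    setIntegral_union hdisj (measurableSet_Ioc.inter measurableSet_Ioi)
      ((integrableOn_Ioc_of_pos hk ha).mono_set Set.inter_subset_left)
      ((integrableOn_Ioc_of_pos hk (ha.trans_le hab)).mono_set Set.inter_subset_left)]

variable (hk0 : ∀ s, 0 < s → 0 ≤ k s) (ha : 0 < a)

include hk hk0 ha

lemma antitone_setIntegral_Ioc_inter_Ioi :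
    Antitone fun t => ∫ s in Set.Ioc a b ∩ Set.Ioi t, k s := fun _ _ hst =>
  setIntegral_mono_set ((integrableOn_Ioc_of_pos hk ha).mono_set Set.inter_subset_left)
    ((ae_nonneg_restrict_Ioc hk0 ha.le).filter_mono
      (ae_mono (Measure.restrict_mono Set.inter_subset_left le_rfl)))
    (Set.inter_subset_inter_right _ (Set.Ioi_subset_Ioi hst)).eventuallyLE

lemma primitiveBetween_le_mul_chi (t : ℝ) :
    primitiveBetween k a b t ≤ (∫ s in Set.Ioc a b, k s) * chi b t := by
  have hint : 0 ≤ ∫ s in Set.Ioc a b, k s :=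
    integral_nonneg_of_ae (ae_nonneg_restrict_Ioc hk0 ha.le)
  rcases le_or_gt t 0 with ht | ht
  · rw [primitiveBetween_of_nonpos ht]
    exact mul_nonneg hint (chi_nonneg b t)
  rw [primitiveBetween_of_pos ht]
  rcases lt_or_ge t b with htb | htb
  · rw [chi_of_mem ⟨ht, htb⟩, mul_one]
    exact setIntegral_mono_set (integrableOn_Ioc_of_pos hk ha) (ae_nonneg_restrict_Ioc hk0 ha.le)
      Set.inter_subset_left.eventuallyLE
  · have hempty : Set.Ioc a b ∩ Set.Ioi t = ∅ :=
      Set.eq_empty_of_forall_notMem fun s hs => (hs.1.2.trans htb).not_gt hs.2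
    rw [hempty, setIntegral_empty]
    exact mul_nonneg hint (chi_nonneg b t)

omit hk0 in
lemma dist_primitiveBetween_le {L : NNReal} (hL : ∀ s ∈ Set.Icc a b, ‖k s‖ ≤ L) {s : ℝ}
    (hs : 0 < s) (hst : s ≤ t) :
    dist (primitiveBetween k a b s) (primitiveBetween k a b t) ≤ L * dist s t := by
  have hsplit : Set.Ioc a b ∩ Set.Ioi s =
      Set.Ioc a b ∩ Set.Ioi t ∪ Set.Ioc a b ∩ Set.Ioc s t := by
    rw [← Set.inter_union_distrib_left, Set.union_comm, Set.Ioc_union_Ioi_eq_Ioi hst]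
  have hdisj : Disjoint (Set.Ioc a b ∩ Set.Ioi t) (Set.Ioc a b ∩ Set.Ioc s t) :=
    Set.disjoint_left.2 fun x hx hx' => hx'.2.2.not_gt hx.2
  have hint := integrableOn_Ioc_of_pos (b := b) hk ha
  have hvol : volume (Set.Ioc a b ∩ Set.Ioc s t) ≤ volume (Set.Ioc s t) :=
    measure_mono Set.inter_subset_right
  have hfin : volume (Set.Ioc s t) < ⊤ := measure_Ioc_lt_top
  rw [primitiveBetween_of_pos hs, primitiveBetween_of_pos (hs.trans_le hst), hsplit,
    setIntegral_union hdisj (measurableSet_Ioc.inter measurableSet_Ioc)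
      (hint.mono_set Set.inter_subset_left) (hint.mono_set Set.inter_subset_left),
    dist_eq_norm, add_sub_cancel_left]
  calc ‖∫ x in Set.Ioc a b ∩ Set.Ioc s t, k x‖
      ≤ L * volume.real (Set.Ioc a b ∩ Set.Ioc s t) :=
        norm_setIntegral_le_of_norm_le_const (hvol.trans_lt hfin)
          fun x hx => hL x (Set.Ioc_subset_Icc_self hx.1)
    _ ≤ L * volume.real (Set.Ioc s t) :=
        mul_le_mul_of_nonneg_left (measureReal_mono Set.inter_subset_right hfin.ne) L.2
    _ = L * dist s t := by
        rw [Real.volume_real_Ioc_of_le hst, dist_comm, Real.dist_eq,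
          abs_of_nonneg (sub_nonneg.2 hst)]

omit hk0 in
lemma primitiveBetween_lipschitzOn :
    ∃ L, LipschitzOnWith L (primitiveBetween k a b) (Set.Ioi 0) := by
  have hcont : ContinuousOn k (Set.Icc a b) := hk.mono fun s hs => ha.trans_le hs.1
  obtain ⟨C, hC⟩ := isCompact_Icc.exists_bound_of_continuousOn hcont
  have hL : ∀ s ∈ Set.Icc a b, ‖k s‖ ≤ C.toNNReal :=
    fun s hs => (hC s hs).trans (Real.le_coe_toNNReal C)
  refine ⟨C.toNNReal, LipschitzOnWith.of_dist_le_mul fun s hs t ht => ?_⟩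
  rcases le_total s t with hst | hts
  · exact dist_primitiveBetween_le hk ha hL hs hst
  · rw [dist_comm, dist_comm s]
    exact dist_primitiveBetween_le hk ha hL ht hts

lemma decreasingProfile_primitiveBetween : DecreasingProfile (primitiveBetween k a b) where
  bddSupp := by
    refine ⟨(antitone_setIntegral_Ioc_inter_Ioi hk hk0 ha).measurable.indicator measurableSet_Ioi,
      ⟨∫ s in Set.Ioc a b, k s, fun t => ?_⟩, b, fun t ht => ?_⟩
    · rw [abs_of_nonneg (primitiveBetween_nonneg hk0 t)]
      exact (primitiveBetween_le_mul_chi hk hk0 ha t).trans (mul_le_of_le_one_right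
        (integral_nonneg_of_ae (ae_nonneg_restrict_Ioc hk0 ha.le)) (chi_le_one b t))
    · have hpos := (primitiveBetween_nonneg hk0 t).lt_of_ne' ht
      have hchi : chi b t ≠ 0 := fun h0 =>
        (hpos.trans_le (primitiveBetween_le_mul_chi hk hk0 ha t)).ne' (by rw [h0, mul_zero])
      exact Set.Ioo_subset_Ico_self (support_chi_subset b hchi)
  support_subset := Set.support_indicator_subset
  nonneg := primitiveBetween_nonneg hk0
  antitoneOn _ hs _ ht hst := by
    rw [primitiveBetween_of_pos hs, primitiveBetween_of_pos ht]
    exact antitone_setIntegral_Ioc_inter_Ioi hk hk0 ha hst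
  lipschitzOn := primitiveBetween_lipschitzOn hk ha

lemma primitiveBetween_mono_Ioc {a' b' : ℝ} (ha' : a ≤ a') (hb' : b' ≤ b) (t : ℝ) :
    primitiveBetween k a' b' t ≤ primitiveBetween k a b t :=
  Set.indicator_le_indicator <| setIntegral_mono_set
    ((integrableOn_Ioc_of_pos hk ha).mono_set Set.inter_subset_left)
    ((ae_nonneg_restrict_Ioc hk0 ha.le).filter_mono
      (ae_mono (Measure.restrict_mono Set.inter_subset_left le_rfl)))
    (Set.inter_subset_inter_left _ (Set.Ioc_subset_Ioc ha' hb')).eventuallyLE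

lemma primitiveBetween_dilate_le (hab : a ≤ b) {η N M : ℝ} (hη : 0 < η) (hηN : η ≤ N)
    (hN1 : N ≤ 1) (hM0 : 0 ≤ M) (hM : ∀ s, 0 < s → k (s / N) / N ≤ M * k s) (t : ℝ) :
    primitiveBetween k a b (t / N) ≤
      M * (primitiveBetween k a b t + primitiveBetween k (η * a) a t) := by
  have hN : 0 < N := hη.trans_le hηN
  have hηa : 0 < η * a := mul_pos hη ha
  calc primitiveBetween k a b (t / N)
      = primitiveBetween (fun s => k (s / N) / N) (N * a) (N * b) t :=
        primitiveBetween_dilate k hN a b t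
    _ ≤ primitiveBetween (fun s => M * k s) (N * a) (N * b) t :=
        primitiveBetween_mono_weight (continuousOn_dilate hk hN) (continuousOn_const.mul hk) hM
          (mul_pos hN ha) t
    _ = M * primitiveBetween k (N * a) (N * b) t := primitiveBetween_const_mul k M _ _ t
    _ ≤ M * primitiveBetween k (η * a) b t := by
        gcongr
        exact primitiveBetween_mono_Ioc hk hk0 hηa (mul_le_mul_of_nonneg_right hηN ha.le)
          (mul_le_of_le_one_left (ha.le.trans hab) hN1) t
    _ = M * (primitiveBetween k a b t + primitiveBetween k (η * a) a t) := by
        rw [add_comm, primitiveBetween_add hk hηa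
          (mul_le_of_le_one_left ha.le (hηN.trans hN1)) hab]

lemma le_primitiveBetween_dilate (hab : a ≤ b) {η N m : ℝ} (hη : 0 < η) (hηN : η ≤ N)
    (hN1 : N ≤ 1) (hm0 : 0 ≤ m) (hm : ∀ s, 0 < s → m * k s ≤ k (s / N) / N) (t : ℝ) :
    m * primitiveBetween k a b t ≤
      primitiveBetween k a b (t / N) + m * primitiveBetween k (η * b) b t := by
  have hN : 0 < N := hη.trans_le hηN
  have hNa : 0 < N * a := mul_pos hN ha
  have hb : 0 < b := ha.trans_le hab
  have hdilate : m * primitiveBetween k (N * a) (N * b) t ≤ primitiveBetween k a b (t / N) := by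
    rw [primitiveBetween_dilate k hN, ← primitiveBetween_const_mul]
    exact primitiveBetween_mono_weight (continuousOn_const.mul hk) (continuousOn_dilate hk hN) hm
      hNa t
  calc m * primitiveBetween k a b t ≤ m * primitiveBetween k (N * a) b t := by
        gcongr
        exact primitiveBetween_mono_Ioc hk hk0 hNa (mul_le_of_le_one_left ha.le hN1) le_rfl t
    _ = m * primitiveBetween k (N * a) (N * b) t + m * primitiveBetween k (N * b) b t := by
        rw [← mul_add, primitiveBetween_add hk hNa (mul_le_mul_of_nonneg_left hab hN.le)
          (mul_le_of_le_one_left hb.le hN1)]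
    _ ≤ primitiveBetween k a b (t / N) + m * primitiveBetween k (η * b) b t := by
        gcongr
        exact primitiveBetween_mono_Ioc hk hk0 (mul_pos hη hb)
          (mul_le_mul_of_nonneg_right hηN hb.le) le_rfl t

end Primitive

/-- The weight `min ((s/c)^e, (c/s)^e) s^(-θ-1)`: it is comparable to `s^(-θ-1)` near `c` and is
damped away from `c`, so slowly that it is still almost homogeneous. -/
def hatWeight (θ e c s : ℝ) : ℝ := Real.exp (-e * |Real.log (s / c)|) * s ^ (-θ - 1)

section HatWeight

variable {θ e c : ℝ}

lemma hatWeight_pos {s : ℝ} (hs : 0 < s) : 0 < hatWeight θ e c s := by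
  unfold hatWeight
  positivity

lemma mul_hatWeight_self (hc : 0 < c) : c * hatWeight θ e c c = c ^ (-θ) := by
  rw [hatWeight, div_self hc.ne', Real.log_one, abs_zero, mul_zero, Real.exp_zero, one_mul,
    Real.rpow_sub_one hc.ne', mul_div_cancel₀ _ hc.ne']

lemma mul_hatWeight_of_le (hc : 0 < c) {s : ℝ} (hs : 0 < s) (hsc : s ≤ c) :
    s * hatWeight θ e c s = (s / c) ^ e * s ^ (-θ) := by
  have hlog : Real.log (s / c) ≤ 0 := Real.log_nonpos (by positivity) ((div_le_one hc).2 hsc)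
  rw [hatWeight, abs_of_nonpos hlog, Real.rpow_def_of_pos (div_pos hs hc),
    Real.rpow_sub_one hs.ne', neg_mul_neg, mul_comm e]
  field_simp

lemma mul_hatWeight_of_ge (hc : 0 < c) {s : ℝ} (hcs : c ≤ s) :
    s * hatWeight θ e c s = (c / s) ^ e * s ^ (-θ) := by
  have hs := hc.trans_le hcs
  have hlog : 0 ≤ Real.log (s / c) := Real.log_nonneg ((one_le_div hc).2 hcs)
  rw [hatWeight, abs_of_nonneg hlog, Real.rpow_def_of_pos (div_pos hc hs),
    Real.rpow_sub_one hs.ne', ← inv_div s c, Real.log_inv, neg_mul, neg_mul, mul_comm e]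
  field_simp

lemma continuousOn_hatWeight (hc : 0 < c) : ContinuousOn (hatWeight θ e c) (Set.Ioi 0) := by
  refine ContinuousOn.mul (Real.continuous_exp.comp_continuousOn (continuousOn_const.mul
    (ContinuousOn.abs (ContinuousOn.log (continuousOn_id.div_const c) fun s hs => ?_)))) ?_
  · exact (div_pos hs hc).ne'
  · exact continuousOn_id.rpow_const fun s hs => Or.inl (ne_of_gt hs)

section Dilate

variable (hc : 0 < c) (he : 0 ≤ e) {N s : ℝ} (hN : 0 < N) (hN1 : N ≤ 1) (hs : 0 < s)

include hN hs

lemma hatWeight_dilate : hatWeight θ e c (s / N) / N =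
    N ^ θ * (Real.exp (-e * |Real.log (s / N / c)|) * s ^ (-θ - 1)) := by
  have hpow : (s / N) ^ (-θ - 1) = s ^ (-θ - 1) * N ^ θ * N := by
    rw [Real.div_rpow hs.le hN.le, div_eq_mul_inv, ← Real.rpow_neg hN.le, mul_assoc,
      ← Real.rpow_add_one hN.ne', neg_sub', neg_neg, sub_neg_eq_add]
  rw [hatWeight, hpow]
  field_simp

include hc he hN1

lemma hatWeight_dilate_le : hatWeight θ e c (s / N) / N ≤ N ^ (θ - e) * hatWeight θ e c s := by
  have hlog : |Real.log (s / c)| ≤ |Real.log (s / N / c)| - Real.log N := by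
    have h := abs_add_le (Real.log (s / N / c)) (Real.log N)
    rw [← Real.log_mul (by positivity) hN.ne', abs_of_nonpos (Real.log_nonpos hN.le hN1)] at h
    rw [show s / c = s / N / c * N by field_simp]
    linarith
  have hexp : Real.exp (-e * |Real.log (s / N / c)|) ≤
      N ^ (-e) * Real.exp (-e * |Real.log (s / c)|) := by
    rw [Real.rpow_def_of_pos hN, ← Real.exp_add]
    gcongr
    linarith [mul_le_mul_of_nonneg_left hlog he]
  rw [hatWeight_dilate hN hs, hatWeight, sub_eq_add_neg θ e, Real.rpow_add hN, mul_assoc,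
    ← mul_assoc (N ^ (-e))]
  gcongr

lemma le_hatWeight_dilate : N ^ (θ + e) * hatWeight θ e c s ≤ hatWeight θ e c (s / N) / N := by
  have hlog : |Real.log (s / N / c)| ≤ |Real.log (s / c)| - Real.log N := by
    have h := abs_sub (Real.log (s / c)) (Real.log N)
    rw [← Real.log_div (by positivity) hN.ne', abs_of_nonpos (Real.log_nonpos hN.le hN1)] at h
    rw [div_right_comm]
    linarith
  have hexp : N ^ e * Real.exp (-e * |Real.log (s / c)|) ≤
      Real.exp (-e * |Real.log (s / N / c)|) := by
    rw [Real.rpow_def_of_pos hN, ← Real.exp_add]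
    gcongr
    linarith [mul_le_mul_of_nonneg_left hlog he]
  rw [hatWeight_dilate hN hs, hatWeight, Real.rpow_add hN, mul_assoc, ← mul_assoc (N ^ e)]
  gcongr

end Dilate

variable (hc : 0 < c) (he : 0 ≤ e) {x y : ℝ} (hx : 0 < x) (hxy : x ≤ y)

include hc he hx hxy

lemma div_rpow_mul_hatWeight_le :
    (x / y) ^ (θ + e + 1) * hatWeight θ e c x ≤ hatWeight θ e c y := by
  have hy := hx.trans_le hxy
  have h := le_hatWeight_dilate (θ := θ) hc he (div_pos hx hy) ((div_le_one hy).2 hxy) hx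
  rwa [div_div_cancel₀ hx.ne', le_div_iff₀ (div_pos hx hy), mul_right_comm,
    ← Real.rpow_add_one (div_pos hx hy).ne'] at h

lemma inv_rpow_mul_hatWeight_le (hθe : 0 ≤ θ + e + 1) {C : ℝ} (hC : y ≤ C * x) :
    (C⁻¹) ^ (θ + e + 1) * hatWeight θ e c x ≤ hatWeight θ e c y := by
  have hy := hx.trans_le hxy
  have hC0 : 0 < C := pos_of_mul_pos_left (hy.trans_le hC) hx.le
  have hratio : C⁻¹ ≤ x / y := by rwa [inv_le_comm₀ hC0 (div_pos hx hy), inv_div, div_le_iff₀ hx]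
  refine le_trans ?_ (div_rpow_mul_hatWeight_le hc he hx hxy)
  gcongr
  exact (hatWeight_pos hx).le

end HatWeight

lemma setIntegral_hatWeight_le {θ e c η x : ℝ} (hθe : 0 ≤ θ + e + 1) (he : 0 ≤ e) (hc : 0 < c)
    (hη : 0 < η) (hη1 : η ≤ 1) (hx : 0 < x) :
    ∫ s in Set.Ioc (η * x) x, hatWeight θ e c s ≤
      (η⁻¹) ^ (θ + e + 1) * (x * hatWeight θ e c x) := by
  have hηx : 0 < η * x := mul_pos hη hx
  have hweight : ∀ s ∈ Set.Ioc (η * x) x,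
      hatWeight θ e c s ≤ (η⁻¹) ^ (θ + e + 1) * hatWeight θ e c x := by
    intro s hs
    have h := inv_rpow_mul_hatWeight_le hc he (hηx.trans hs.1) hs.2 hθe
      (C := η⁻¹) (by rw [inv_mul_eq_div, le_div_iff₀ hη]; linarith [hs.1])
    rwa [inv_inv, mul_comm, ← le_div_iff₀ (by positivity), div_eq_inv_mul,
      ← Real.inv_rpow hη.le] at h
  calc ∫ s in Set.Ioc (η * x) x, hatWeight θ e c s
      ≤ ∫ _ in Set.Ioc (η * x) x, (η⁻¹) ^ (θ + e + 1) * hatWeight θ e c x :=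
        setIntegral_mono_on (integrableOn_Ioc_of_pos (continuousOn_hatWeight hc) hηx)
          (integrableOn_const measure_Ioc_lt_top.ne) measurableSet_Ioc hweight
    _ = (x - η * x) * ((η⁻¹) ^ (θ + e + 1) * hatWeight θ e c x) := by
        rw [setIntegral_const, smul_eq_mul,
          Real.volume_real_Ioc_of_le (mul_le_of_le_one_left hx.le hη1)]
    _ ≤ x * ((η⁻¹) ^ (θ + e + 1) * hatWeight θ e c x) := by
        have := hatWeight_pos (θ := θ) (e := e) (c := c) hx
        gcongr
        linarith
    _ = (η⁻¹) ^ (θ + e + 1) * (x * hatWeight θ e c x) := mul_left_comm _ _ _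

lemma two_rpow_mul_le_primitiveBetween {θ e a b c : ℝ} (hθe : 0 ≤ θ + e + 1) (he : 0 ≤ e)
    (ha : 0 < a) (hac : a ≤ c) (hcb : 2 * c ≤ b) :
    (2⁻¹ : ℝ) ^ (θ + e + 1) * (c * hatWeight θ e c c) ≤
      primitiveBetween (hatWeight θ e c) a b c := by
  have hc := ha.trans_le hac
  have hcont := continuousOn_hatWeight (θ := θ) (e := e) hc
  calc (2⁻¹ : ℝ) ^ (θ + e + 1) * (c * hatWeight θ e c c)
      = ∫ _ in Set.Ioc c (2 * c), (2⁻¹ : ℝ) ^ (θ + e + 1) * hatWeight θ e c c := by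
        rw [setIntegral_const, smul_eq_mul, Real.volume_real_Ioc_of_le (by linarith)]
        ring
    _ ≤ ∫ s in Set.Ioc c (2 * c), hatWeight θ e c s :=
        setIntegral_mono_on (integrableOn_const measure_Ioc_lt_top.ne)
          (integrableOn_Ioc_of_pos hcont hc) measurableSet_Ioc
          fun s hs => inv_rpow_mul_hatWeight_le hc he hc hs.1.le hθe hs.2
    _ ≤ ∫ s in Set.Ioc a b ∩ Set.Ioi c, hatWeight θ e c s :=
        setIntegral_mono_set
          ((integrableOn_Ioc_of_pos hcont ha).mono_set Set.inter_subset_left)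
          ((ae_nonneg_restrict_Ioc (fun s hs => (hatWeight_pos hs).le) ha.le).filter_mono
            (ae_mono (Measure.restrict_mono Set.inter_subset_left le_rfl)))
          (Set.subset_inter (Set.Ioc_subset_Ioc hac hcb)
            Set.Ioc_subset_Ioi_self).eventuallyLE
    _ = primitiveBetween (hatWeight θ e c) a b c := (primitiveBetween_of_pos hc).symm

/-- The function `t ↦ t^(-θ) φ(t)` has points `c` at which it is, up to the slowly decaying factors
`(a/c)^e` and `(c/b)^e`, much larger than at some point `a` to the left and some point `b` to the
right of `c`. -/
def HasDampedPeaks (φ : ℝ → ℝ) (θ : ℝ) : Prop :=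
  ∀ e δ : ℝ, 0 < e → 0 < δ → ∃ a c b : ℝ, 0 < a ∧ a ≤ c ∧ c ≤ b ∧
    φ a * ((a / c) ^ e * a ^ (-θ)) ≤ δ * (φ c * c ^ (-θ)) ∧
    φ b * ((c / b) ^ e * b ^ (-θ)) ≤ δ * (φ c * c ^ (-θ))

section AlmostHomogeneous

variable {E : Type*} [NormedAddCommGroup E] [NormedSpace ℝ E] {ι : E →ₗ[ℝ] S}

/-- Decreasing profiles whose dilation by `N ∈ [η, 1]` acts as multiplication by `N^θ`, up to the
factor `1 + κ` and a remainder which is relatively small in norm. -/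
structure AlmostHomogeneous (ι : E →ₗ[ℝ] S) (θ η κ : ℝ) (F : ℝ → ℝ) : Prop where
  profile : DecreasingProfile F
  fnNorm_pos : 0 < fnNorm ι F
  dilate : ∃ r, BddSupp r ∧ (∀ t, 0 ≤ r t) ∧ fnNorm ι r ≤ κ * fnNorm ι F ∧
    ∀ N ∈ Set.Icc η 1, ∀ t,
      F (t / N) ≤ (1 + κ) * (N ^ θ * F t) + r t ∧ N ^ θ * F t ≤ (1 + κ) * F (t / N) + r t

lemma IsRISpace.mul_fnNorm_chi_le (hι : IsRISpace ι) {F : ℝ → ℝ} (hF : DecreasingProfile F) {c : ℝ}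
    (hc : 0 < c) : F c * fnNorm ι (chi c) ≤ fnNorm ι F := by
  have hsmul := hι.fnNorm_const_smul (.chi c) (F c)
  rw [abs_of_nonneg (hF.nonneg c)] at hsmul
  rw [← hsmul]
  refine hι.fnNorm_mono_of_nonneg (.const_smul (.chi c) _) hF.bddSupp
    (fun t => mul_nonneg (hF.nonneg c) (chi_nonneg c t)) fun t ht => ?_
  rw [Pi.smul_apply, smul_eq_mul]
  rcases lt_or_ge t c with htc | hct
  · rw [chi_of_mem ⟨ht, htc⟩, mul_one]
    exact hF.antitoneOn ht hc htc.le
  · rw [Function.notMem_support.1 fun h => hct.not_gt (support_chi_subset c h).2, mul_zero]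
    exact hF.nonneg t

lemma IsRISpace.fnNorm_primitiveBetween_le (hι : IsRISpace ι) {k : ℝ → ℝ}
    (hk : ContinuousOn k (Set.Ioi 0)) (hk0 : ∀ s, 0 < s → 0 ≤ k s) {a b : ℝ} (ha : 0 < a) :
    fnNorm ι (primitiveBetween k a b) ≤ (∫ s in Set.Ioc a b, k s) * fnNorm ι (chi b) := by
  have hint : 0 ≤ ∫ s in Set.Ioc a b, k s :=
    integral_nonneg_of_ae (ae_nonneg_restrict_Ioc hk0 ha.le)
  have hsmul := hι.fnNorm_const_smul (.chi b) (∫ s in Set.Ioc a b, k s)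
  rw [abs_of_nonneg hint] at hsmul
  rw [← hsmul]
  exact hι.fnNorm_mono_of_nonneg (decreasingProfile_primitiveBetween hk hk0 ha).bddSupp
    (.const_smul (.chi b) _) (primitiveBetween_nonneg hk0)
    fun t _ => primitiveBetween_le_mul_chi hk hk0 ha t

lemma exists_rpow_neg_le {η κ : ℝ} (hη : 0 < η) (hκ : 0 < κ) :
    ∃ e : ℝ, 0 < e ∧ η ^ (-e) ≤ 1 + κ := by
  have hcont : Tendsto (fun e : ℝ => η ^ (-e)) (𝓝[>] 0) (𝓝 1) := by
    have h : ContinuousAt (fun e : ℝ => η ^ (-e)) 0 :=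
      (Real.continuousAt_const_rpow hη.ne').comp continuousAt_neg
    simpa only [ContinuousAt, neg_zero, Real.rpow_zero] using h.mono_left nhdsWithin_le_nhds
  obtain ⟨e, hle, he⟩ :=
    ((hcont.eventually_le_const (lt_add_of_pos_right 1 hκ)).and self_mem_nhdsWithin).exists
  exact ⟨e, he, hle⟩

lemma primitiveBetween_hatWeight_dilate {θ e a b c η κ : ℝ} (hθ : 0 ≤ θ) (he : 0 < e) (hc : 0 < c)
    (ha : 0 < a) (hab : a ≤ b) (hη : 0 < η) (hκ : η ^ (-e) ≤ 1 + κ) {N : ℝ}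
    (hN : N ∈ Set.Icc η 1) (t : ℝ) :
    let F := primitiveBetween (hatWeight θ e c)
    F a b (t / N) ≤ (1 + κ) * (N ^ θ * F a b t) + (1 + κ) * (F (η * a) a t + F (η * b) b t) ∧
    N ^ θ * F a b t ≤ (1 + κ) * F a b (t / N) + (1 + κ) * (F (η * a) a t + F (η * b) b t) := by
  intro F
  have hN0 : 0 < N := hη.trans_le hN.1
  have hcont := continuousOn_hatWeight (θ := θ) (e := e) hc
  have hk0 : ∀ s, 0 < s → 0 ≤ hatWeight θ e c s := fun s hs => (hatWeight_pos hs).le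
  have hF0 : ∀ x y t, 0 ≤ F x y t := fun x y t => primitiveBetween_nonneg hk0 t
  have hNe : N ^ (-e) ≤ 1 + κ :=
    (Real.rpow_le_rpow_of_nonpos hη hN.1 (neg_nonpos.2 he.le)).trans hκ
  have hκ0 : 0 ≤ 1 + κ := (Real.rpow_nonneg hN0.le _).trans hNe
  have hNθ : N ^ θ ≤ 1 := Real.rpow_le_one hN0.le hN.2 hθ
  constructor
  · calc F a b (t / N) ≤ N ^ (θ - e) * (F a b t + F (η * a) a t) :=
          primitiveBetween_dilate_le hcont hk0 ha hab hη hN.1 hN.2 (by positivity)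
            (fun s hs => hatWeight_dilate_le hc he.le hN0 hN.2 hs) t
      _ = N ^ (-e) * (N ^ θ * F a b t) + N ^ (-e) * (N ^ θ * F (η * a) a t) := by
          rw [sub_eq_add_neg, Real.rpow_add hN0]
          ring
      _ ≤ (1 + κ) * (N ^ θ * F a b t) + (1 + κ) * (1 * (F (η * a) a t + F (η * b) b t)) := by
          have := hF0 a b t
          have := hF0 (η * a) a t
          gcongr
          exact le_add_of_nonneg_right (hF0 _ _ t)
      _ = _ := by rw [one_mul]
  · have hle := le_primitiveBetween_dilate hcont hk0 ha hab hη hN.1 hN.2 (m := N ^ (θ + e))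
      (by positivity) (fun s hs => le_hatWeight_dilate hc he.le hN0 hN.2 hs) t
    calc N ^ θ * F a b t = N ^ (-e) * (N ^ (θ + e) * F a b t) := by
          rw [← mul_assoc, ← Real.rpow_add hN0, neg_add_cancel_comm_assoc]
      _ ≤ (1 + κ) * (F a b (t / N) + 1 * (F (η * a) a t + F (η * b) b t)) := by
          refine mul_le_mul hNe (hle.trans ?_) (mul_nonneg (by positivity) (hF0 a b t)) hκ0
          have := hF0 (η * b) b t
          gcongr
          · exact Real.rpow_le_one hN0.le hN.2 (by positivity)
          · exact le_add_of_nonneg_left (hF0 _ _ t)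
      _ = _ := by rw [one_mul, mul_add]

namespace IsRISpace

section Peak

variable (hι : IsRISpace ι) {θ e c δ : ℝ} (hθ : 0 ≤ θ) (he : 0 < e) (hc : 0 < c)

include hι hθ he hc

lemma two_mul_le_of_damped {b : ℝ} (hcb : c ≤ b) (hδ : δ < 2⁻¹ ^ (θ + e + 1))
    (hdamp : fnNorm ι (chi b) * (b * hatWeight θ e c b) ≤
      δ * (fnNorm ι (chi c) * (c * hatWeight θ e c c))) : 2 * c ≤ b := by
  by_contra! hlt
  have hpos : 0 < fnNorm ι (chi c) * (c * hatWeight θ e c c) :=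
    mul_pos (hι.fnNorm_chi_pos hc) (mul_pos hc (hatWeight_pos hc))
  refine (mul_lt_mul_of_pos_right hδ hpos).not_ge ?_
  calc 2⁻¹ ^ (θ + e + 1) * (fnNorm ι (chi c) * (c * hatWeight θ e c c))
      = fnNorm ι (chi c) * (c * (2⁻¹ ^ (θ + e + 1) * hatWeight θ e c c)) := by ring
    _ ≤ fnNorm ι (chi b) * (b * hatWeight θ e c b) := by
        have := hatWeight_pos (θ := θ) (e := e) (c := c) hc
        gcongr
        · exact fnNorm_nonneg ι _
        · exact hι.fnNorm_chi_mono hcb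
        · exact hc.le.trans hcb
        · exact inv_rpow_mul_hatWeight_le hc he.le hc hcb (by positivity) hlt.le
    _ ≤ _ := hdamp

lemma le_fnNorm_primitiveBetween {a b : ℝ} (ha : 0 < a) (hac : a ≤ c) (hcb : 2 * c ≤ b) :
    2⁻¹ ^ (θ + e + 1) * (fnNorm ι (chi c) * (c * hatWeight θ e c c)) ≤
      fnNorm ι (primitiveBetween (hatWeight θ e c) a b) := by
  have hprofile := decreasingProfile_primitiveBetween (b := b)
    (continuousOn_hatWeight (θ := θ) (e := e) hc) (fun s hs => (hatWeight_pos hs).le) ha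
  refine le_trans (le_of_eq_of_le (mul_left_comm _ _ _) ?_) (hι.mul_fnNorm_chi_le hprofile hc)
  rw [mul_comm]
  gcongr
  · exact fnNorm_nonneg ι _
  · exact two_rpow_mul_le_primitiveBetween (by positivity) he.le ha hac hcb

lemma fnNorm_primitiveBetween_hatWeight_le {η x B : ℝ} (hη : 0 < η) (hη1 : η ≤ 1) (hx : 0 < x)
    (hB : fnNorm ι (chi x) * (x * hatWeight θ e c x) ≤ η ^ (θ + e + 1) * B) :
    fnNorm ι (primitiveBetween (hatWeight θ e c) (η * x) x) ≤ B := by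
  have hint := setIntegral_hatWeight_le (θ := θ) (by positivity) he.le hc hη hη1 hx
  calc fnNorm ι (primitiveBetween (hatWeight θ e c) (η * x) x)
      ≤ (∫ s in Set.Ioc (η * x) x, hatWeight θ e c s) * fnNorm ι (chi x) :=
        hι.fnNorm_primitiveBetween_le (continuousOn_hatWeight hc)
          (fun s hs => (hatWeight_pos hs).le) (mul_pos hη hx)
    _ ≤ η⁻¹ ^ (θ + e + 1) * (x * hatWeight θ e c x) * fnNorm ι (chi x) :=
        mul_le_mul_of_nonneg_right hint (fnNorm_nonneg ι _)
    _ = η⁻¹ ^ (θ + e + 1) * (fnNorm ι (chi x) * (x * hatWeight θ e c x)) := by ring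
    _ ≤ η⁻¹ ^ (θ + e + 1) * (η ^ (θ + e + 1) * B) := by gcongr
    _ = B := by
        rw [← mul_assoc, ← Real.mul_rpow (by positivity) hη.le, inv_mul_cancel₀ hη.ne',
          Real.one_rpow, one_mul]

lemma fnNorm_remainder_le {a b η ρ x : ℝ} (ha : 0 < a) (hac : a ≤ c) (hcb : 2 * c ≤ b)
    (hη : 0 < η) (hη1 : η ≤ 1) (hρ : 0 ≤ ρ) (hx : 0 < x)
    (hdamp : fnNorm ι (chi x) * (x * hatWeight θ e c x) ≤
      η ^ (θ + e + 1) * (ρ * 2⁻¹ ^ (θ + e + 1)) * (fnNorm ι (chi c) * (c * hatWeight θ e c c))) :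
    fnNorm ι (primitiveBetween (hatWeight θ e c) (η * x) x) ≤
      ρ * fnNorm ι (primitiveBetween (hatWeight θ e c) a b) := by
  refine hι.fnNorm_primitiveBetween_hatWeight_le hθ he hc hη hη1 hx (hdamp.trans ?_)
  rw [mul_assoc, mul_assoc]
  gcongr
  exact hι.le_fnNorm_primitiveBetween hθ he hc ha hac hcb

end Peak

theorem exists_almostHomogeneous (hι : IsRISpace ι) {θ η κ : ℝ} (hθ : 0 ≤ θ)
    (hpeaks : HasDampedPeaks (fun t => fnNorm ι (chi t)) θ) (hη : 0 < η) (hη1 : η ≤ 1)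
    (hκ : 0 < κ) : ∃ F, AlmostHomogeneous ι θ η κ F := by
  obtain ⟨e, he, hηe⟩ := exists_rpow_neg_le hη hκ
  set ρ : ℝ := κ / (1 + κ) / 2 with hρ
  have hρ0 : 0 < ρ := by positivity
  have hρ1 : ρ < 1 := by rw [hρ, div_div, div_lt_one (by positivity)]; linarith
  have hη_rpow : η ^ (θ + e + 1) ≤ 1 := Real.rpow_le_one hη.le hη1 (by positivity)
  have htwo_rpow : (0 : ℝ) < 2⁻¹ ^ (θ + e + 1) := by positivity
  obtain ⟨a, c, b, ha, hac, hcb, hdamp_a, hdamp_b⟩ :=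
    hpeaks e (η ^ (θ + e + 1) * (ρ * 2⁻¹ ^ (θ + e + 1))) he (by positivity)
  have hc := ha.trans_le hac
  have hb := hc.trans_le hcb
  rw [← mul_hatWeight_of_le hc ha hac, ← mul_hatWeight_self (θ := θ) (e := e) hc] at hdamp_a
  rw [← mul_hatWeight_of_ge hc hcb, ← mul_hatWeight_self (θ := θ) (e := e) hc] at hdamp_b
  have h2c : 2 * c ≤ b := hι.two_mul_le_of_damped hθ he hc hcb
    ((mul_le_of_le_one_left (by positivity) hη_rpow).trans_lt
      (mul_lt_of_lt_one_left htwo_rpow hρ1)) hdamp_b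
  set F := primitiveBetween (hatWeight θ e c)
  have hprofile {x y : ℝ} (hx : 0 < x) : DecreasingProfile (F x y) :=
    decreasingProfile_primitiveBetween (continuousOn_hatWeight hc)
      (fun s hs => (hatWeight_pos hs).le) hx
  have hr_a := hprofile (y := a) (mul_pos hη ha)
  have hr_b := hprofile (y := b) (mul_pos hη hb)
  refine ⟨F a b, hprofile ha, ?_, (1 + κ) • (F (η * a) a + F (η * b) b),
    .const_smul (hr_a.bddSupp.add hr_b.bddSupp) _,
    fun t => mul_nonneg (by positivity) (add_nonneg (hr_a.nonneg t) (hr_b.nonneg t)), ?_,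
    fun N hN t => primitiveBetween_hatWeight_dilate hθ he hc ha (hac.trans hcb) hη hηe hN t⟩
  · have := hι.fnNorm_chi_pos hc
    have := hatWeight_pos (θ := θ) (e := e) (c := c) hc
    exact lt_of_lt_of_le (by positivity) (hι.le_fnNorm_primitiveBetween hθ he hc ha hac h2c)
  · calc fnNorm ι ((1 + κ) • (F (η * a) a + F (η * b) b))
        ≤ (1 + κ) * (ρ * fnNorm ι (F a b) + ρ * fnNorm ι (F a b)) := by
          rw [hι.fnNorm_const_smul (hr_a.bddSupp.add hr_b.bddSupp), abs_of_nonneg (by positivity)]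
          gcongr
          exact (hι.fnNorm_add_le hr_a.bddSupp hr_b.bddSupp).trans (add_le_add
            (hι.fnNorm_remainder_le hθ he hc ha hac h2c hη hη1 hρ0.le ha hdamp_a)
            (hι.fnNorm_remainder_le hθ he hc ha hac h2c hη hη1 hρ0.le hb hdamp_b))
      _ = κ * fnNorm ι (F a b) := by
          rw [hρ]
          field_simp
          ring

end IsRISpace

end AlmostHomogeneous

/-- The sum of the translates of the functions `g k` by `k * d`. -/
def translateSum {n : ℕ} (d : ℝ) (g : Fin n → ℝ → ℝ) : ℝ → ℝ := ∑ k, fun t => g k (t - k * d)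

section Translates

variable {n : ℕ} {d : ℝ} {g h : Fin n → ℝ → ℝ}

lemma translateSum_apply (d : ℝ) (g : Fin n → ℝ → ℝ) (t : ℝ) :
    translateSum d g t = ∑ k, g k (t - k * d) :=
  Finset.sum_apply t _ _

lemma translateSum_add (d : ℝ) (g h : Fin n → ℝ → ℝ) :
    translateSum d (fun k => g k + h k) = translateSum d g + translateSum d h :=
  Finset.sum_add_distrib

lemma translateSum_smul (d C : ℝ) (g : Fin n → ℝ → ℝ) :
    translateSum d (fun k => C • g k) = C • translateSum d g := by
  funext t
  simp only [translateSum_apply, Pi.smul_apply, Finset.smul_sum]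

lemma translateSum_nonneg (hg : ∀ k t, 0 ≤ g k t) (t : ℝ) : 0 ≤ translateSum d g t := by
  rw [translateSum_apply]
  exact Finset.sum_nonneg fun k _ => hg k _

lemma eq_of_mem_support_translate {f f' : ℝ → ℝ} (hf : Function.support f ⊆ Set.Ico 0 d)
    (hf' : Function.support f' ⊆ Set.Ico 0 d) {j k : Fin n} {t : ℝ} (hj : f (t - j * d) ≠ 0)
    (hk : f' (t - k * d) ≠ 0) : j = k := by
  obtain ⟨hj0, hjd⟩ := hf hj
  obtain ⟨hk0, hkd⟩ := hf' hk
  by_contra hne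
  rcases lt_or_gt_of_ne hne with hlt | hlt
  · have : (j : ℝ) + 1 ≤ k := by exact_mod_cast hlt
    nlinarith
  · have : (k : ℝ) + 1 ≤ j := by exact_mod_cast hlt
    nlinarith

lemma translateSum_eq (hg : ∀ k, Function.support (g k) ⊆ Set.Ico 0 d) {k : Fin n} {t : ℝ}
    (hk : g k (t - k * d) ≠ 0) : translateSum d g t = g k (t - k * d) := by
  rw [translateSum_apply]
  refine Finset.sum_eq_single k (fun j _ hj => ?_) fun hmem => (hmem (Finset.mem_univ k)).elim
  by_contra hne
  exact hj (eq_of_mem_support_translate (hg j) (hg k) hne hk)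

lemma abs_translateSum (hg : ∀ k, Function.support (g k) ⊆ Set.Ico 0 d) (t : ℝ) :
    |translateSum d g t| = translateSum d (fun k t => |g k t|) t := by
  by_cases hex : ∃ k, g k (t - k * d) ≠ 0
  · obtain ⟨k, hk⟩ := hex
    rw [translateSum_eq hg hk, translateSum_eq (g := fun k t => |g k t|) (k := k)
      (fun k t ht => hg k (abs_ne_zero.1 ht)) (abs_ne_zero.2 hk)]
  · push Not at hex
    simp [translateSum_apply, hex]

variable (hd : 0 ≤ d)

include hd

lemma BddSupp.translateSum (hg : ∀ k, BddSupp (g k)) : BddSupp (translateSum d g) :=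
  BddSupp.sum _ fun k _ => (hg k).shift (by positivity)

lemma distribution_translateSum (hb : ∀ k, BddSupp (g k))
    (hg : ∀ k, Function.support (g k) ⊆ Set.Ico 0 d) {τ : ℝ} (hτ : 0 ≤ τ) :
    distribution (translateSum d g) τ = ∑ k, distribution (g k) τ := by
  have hshift : ∀ k : Fin n, BddSupp fun t => g k (t - k * d) := fun k =>
    (hb k).shift (by positivity)
  have hne {x : ℝ} (hx : τ < |x|) : x ≠ 0 := abs_pos.1 (hτ.trans_lt hx)
  have hlevel : {s | τ < |translateSum d g s|} =
      ⋃ k ∈ (Finset.univ : Finset (Fin n)), {s | τ < |g k (s - k * d)|} := by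
    ext s
    simp only [Finset.mem_univ, Set.iUnion_true, Set.mem_iUnion, Set.mem_ofPred_eq]
    constructor
    · intro hs
      obtain ⟨k, -, hk⟩ := Finset.exists_ne_zero_of_sum_ne_zero
        ((translateSum_apply d g s).symm.trans_ne (hne hs))
      exact ⟨k, by rwa [translateSum_eq hg hk] at hs⟩
    · rintro ⟨k, hk⟩
      rwa [translateSum_eq hg (hne hk)]
  rw [distribution_eq_volume (BddSupp.translateSum hd hb).support_subset_Ici hτ, hlevel,
    measure_biUnion_finset]
  · refine Finset.sum_congr rfl fun k _ => ?_
    rw [← distribution_shift (hb k).support_subset_Ici (by positivity : 0 ≤ (k : ℝ) * d) hτ,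
      distribution_eq_volume (hshift k).support_subset_Ici hτ]
  · intro j _ k _ hjk
    exact Set.disjoint_left.2 fun s hj hk =>
      hjk (eq_of_mem_support_translate (hg j) (hg k) (hne hj) (hne hk))
  · exact fun k _ => measurableSet_lt measurable_const (hshift k).measurable.abs

variable {E : Type*} [NormedAddCommGroup E] [NormedSpace ℝ E] {ι : E →ₗ[ℝ] S}

lemma IsRISpace.fnNorm_translateSum_le (hι : IsRISpace ι) (hg : ∀ k, BddSupp (g k)) :
    fnNorm ι (translateSum d g) ≤ ∑ k, fnNorm ι (g k) := by
  have hd' (k : Fin n) : 0 ≤ (k : ℝ) * d := by positivity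
  refine (hι.fnNorm_sum_le _ fun k _ => (hg k).shift (hd' k)).trans_eq ?_
  exact Finset.sum_congr rfl fun k _ => hι.fnNorm_shift (hg k) (hd' k)

lemma IsRISpace.fnNorm_translateSum_le_of_le (hι : IsRISpace ι) (hg : ∀ k, BddSupp (g k))
    (hh : ∀ k, BddSupp (h k)) {r : ℝ → ℝ} (hr : BddSupp r) {C : ℝ} (hC : 0 ≤ C)
    (hg0 : ∀ k t, 0 ≤ g k t) (hgh : ∀ k t, g k t ≤ C * h k t + r t) :
    fnNorm ι (translateSum d g) ≤
      C * fnNorm ι (translateSum d h) + n * fnNorm ι r := by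
  have hh' := BddSupp.translateSum hd hh
  have hr' : BddSupp (translateSum d fun _ : Fin n => r) := .translateSum hd fun _ => hr
  calc fnNorm ι (translateSum d g)
      ≤ fnNorm ι (C • translateSum d h + translateSum d fun _ : Fin n => r) := by
        refine hι.fnNorm_mono_of_nonneg (.translateSum hd hg) (.add (.const_smul hh' C) hr')
          (translateSum_nonneg hg0) fun t _ => ?_
        rw [← translateSum_smul, ← translateSum_add, translateSum_apply, translateSum_apply]
        exact Finset.sum_le_sum fun k _ => hgh k _
    _ ≤ C * fnNorm ι (translateSum d h) +
          fnNorm ι (translateSum d fun _ : Fin n => r) := by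
        refine (hι.fnNorm_add_le (.const_smul hh' C) hr').trans_eq ?_
        rw [hι.fnNorm_const_smul hh', abs_of_nonneg hC]
    _ ≤ C * fnNorm ι (translateSum d h) + n * fnNorm ι r := by
        gcongr
        refine (hι.fnNorm_translateSum_le hd fun _ => hr).trans_eq ?_
        rw [Finset.sum_const, Finset.card_univ, Fintype.card_fin, nsmul_eq_mul]

lemma IsRISpace.fnNorm_translateSum_dilate (hι : IsRISpace ι) {F : ℝ → ℝ} (hF : BddSupp F)
    (hFd : Function.support F ⊆ Set.Ioo 0 d) {N : Fin n → ℝ} (hN0 : ∀ k, 0 ≤ N k)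
    (hN : ∑ k, N k = 1) :
    fnNorm ι (translateSum d fun k t => F (t / N k)) = fnNorm ι F := by
  have h0 : F 0 = 0 := Function.notMem_support.1 fun hmem => lt_irrefl 0 (hFd hmem).1
  have hpos : Function.support F ⊆ Set.Ioi 0 := hFd.trans Set.Ioo_subset_Ioi_self
  have hb : ∀ k, BddSupp (fun t => F (t / N k)) := fun k => hF.dilate h0 (hN0 k)
  have hsupp : ∀ k, Function.support (fun t => F (t / N k)) ⊆ Set.Ico 0 d := by
    intro k t ht
    obtain ⟨ht0, htd⟩ := hFd ht
    have hNk : 0 < N k := (hN0 k).lt_of_ne fun hzero => by simp [← hzero] at ht0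
    have hNk1 : N k ≤ 1 := hN ▸ Finset.single_le_sum (fun j _ => hN0 j) (Finset.mem_univ k)
    exact ⟨((div_pos_iff_of_pos_right hNk).1 ht0).le,
      ((div_lt_iff₀ hNk).1 htd).trans_le (mul_le_of_le_one_right hd hNk1)⟩
  refine hι.fnNorm_eq_of_distribution_eq (.translateSum hd hb) hF fun τ hτ => ?_
  rw [distribution_translateSum hd hb hsupp hτ,
    Finset.sum_congr rfl fun k _ => distribution_dilate hpos (hN0 k) hτ, ← Finset.sum_mul,
    ← ENNReal.ofReal_sum_of_nonneg fun k _ => hN0 k, hN, ENNReal.ofReal_one, one_mul]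

end Translates

section NormToLp

variable {n : ℕ} {p : ENNReal} [Fact (1 ≤ p)]

lemma abs_apply_le_norm_toLp (c : Fin n → ℝ) (k : Fin n) : |c k| ≤ ‖WithLp.toLp p c‖ :=
  PiLp.norm_apply_le (WithLp.toLp p c) k

lemma norm_toLp_abs (c : Fin n → ℝ) : ‖WithLp.toLp p fun k => |c k|‖ = ‖WithLp.toLp p c‖ := by
  rcases eq_or_ne p ⊤ with rfl | hp
  · simp only [PiLp.norm_eq_ciSup, Real.norm_eq_abs, abs_abs]
  · have hp0 : 0 < p.toReal :=
      ENNReal.toReal_pos (zero_lt_one.trans_le (Fact.out : 1 ≤ p)).ne' hp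
    simp only [PiLp.norm_eq_sum hp0, Real.norm_eq_abs, abs_abs]

lemma exists_eq_one_of_norm_toLp_top {c : Fin n → ℝ} (hc0 : ∀ k, 0 ≤ c k)
    (hc : ‖WithLp.toLp ⊤ c‖ = 1) : ∃ j, c j = 1 := by
  rw [PiLp.norm_eq_ciSup] at hc
  rcases isEmpty_or_nonempty (Fin n) with hempty | hne
  · rw [Real.iSup_of_isEmpty] at hc
    exact absurd hc zero_ne_one
  · obtain ⟨j, hj⟩ := exists_eq_ciSup_of_finite (f := fun k => ‖(WithLp.toLp ⊤ c) k‖)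
    exact ⟨j, by rw [← hc, ← hj, Real.norm_of_nonneg (hc0 j)]⟩

lemma sum_rpow_eq_one_of_norm_toLp (hp : p ≠ ⊤) {c : Fin n → ℝ} (hc0 : ∀ k, 0 ≤ c k)
    (hc : ‖WithLp.toLp p c‖ = 1) : ∑ k, c k ^ p.toReal = 1 := by
  have hp0 : 0 < p.toReal := ENNReal.toReal_pos (zero_lt_one.trans_le (Fact.out : 1 ≤ p)).ne' hp
  simp only [PiLp.norm_eq_sum hp0, Real.norm_eq_abs, abs_of_nonneg (hc0 _)] at hc
  rw [← Real.rpow_inv_rpow (Finset.sum_nonneg fun k _ => Real.rpow_nonneg (hc0 k) _) hp0.ne',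
    ← one_div, hc, Real.one_rpow]

end NormToLp

section SpansLp

variable {E : Type*} [NormedAddCommGroup E] [NormedSpace ℝ E] {ι : E →ₗ[ℝ] S}

/-- The translates of `F` by `0, d, …, (n - 1) d`, whose norms should be thought of as equal to `W`,
are equivalent to the unit vector basis of `ℓ^p_n` up to the relative error `ε`. -/
def SpansLp (ι : E →ₗ[ℝ] S) (p : ENNReal) (n : ℕ) (d ε W : ℝ) (F : ℝ → ℝ) : Prop :=
  ∀ c : Fin n → ℝ, |fnNorm ι (translateSum d fun k => c k • F) - W * ‖WithLp.toLp p c‖| ≤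
    ε * (W * ‖WithLp.toLp p c‖)

lemma SpansLp.normalize {n : ℕ} {p : ENNReal} {d ε W : ℝ} {F : ℝ → ℝ} (hι : IsRISpace ι)
    (h : SpansLp ι p n d ε W F) (hd : 0 ≤ d) (hF : BddSupp F) (hW : 0 < W) :
    SpansLp ι p n d ε 1 (W⁻¹ • F) := by
  intro c
  have hscale : fnNorm ι (translateSum d fun k => c k • W⁻¹ • F) =
      W⁻¹ * fnNorm ι (translateSum d fun k => c k • F) := by
    simp only [smul_comm _ W⁻¹]
    rw [translateSum_smul, hι.fnNorm_const_smul (.translateSum hd fun k => hF.const_smul _),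
      abs_of_pos (inv_pos.2 hW)]
  rw [one_mul, hscale, ← mul_le_mul_iff_of_pos_left hW, ← abs_of_pos hW, ← abs_mul, mul_sub,
    abs_of_pos hW, mul_inv_cancel_left₀ hW.ne', mul_left_comm]
  exact h c

namespace AlmostHomogeneous

section Bounds

variable {θ η κ : ℝ} {F : ℝ → ℝ} (hF : AlmostHomogeneous ι θ η κ F) (hι : IsRISpace ι)
  (hκ : 0 ≤ κ) {n : ℕ} {d : ℝ} (hd : 0 ≤ d)
  (hFd : Function.support F ⊆ Set.Ioo 0 d) {N : Fin n → ℝ} (hN0 : ∀ k, 0 ≤ N k)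
  (hN : ∑ k, N k = 1) {c : Fin n → ℝ} (hc0 : ∀ k, 0 ≤ c k)

include hF in
lemma bddSupp_dilate {x : ℝ} (hx : 0 ≤ x) : BddSupp fun t => F (t / x) :=
  hF.profile.bddSupp.dilate (hF.profile.apply_of_nonpos le_rfl) hx

include hF hι in
lemma fnNorm_add_smul_le {r : ℝ → ℝ} (hr : BddSupp r) (hrF : fnNorm ι r ≤ κ * fnNorm ι F) {x : ℝ}
    (hx : 0 ≤ x) : fnNorm ι (r + x • F) ≤ (κ + x) * fnNorm ι F := by
  refine (hι.fnNorm_add_le hr (hF.profile.bddSupp.const_smul x)).trans ?_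
  rw [hι.fnNorm_const_smul hF.profile.bddSupp, abs_of_nonneg hx, add_mul]
  gcongr

include hF hι hκ hd hFd hN0 hN hc0

lemma fnNorm_translateSum_le
    (hNc : ∀ k, η ≤ N k ∧ c k ≤ N k ^ θ ∨ c k ≤ κ) :
    fnNorm ι (translateSum d fun k => c k • F) ≤ (1 + κ + 2 * n * κ) * fnNorm ι F := by
  obtain ⟨r, hr, hr0, hrF, hdilate⟩ := hF.dilate
  have hN1 : ∀ k, N k ≤ 1 := fun k => hN ▸ Finset.single_le_sum (fun j _ => hN0 j)
    (Finset.mem_univ k)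
  have hpointwise : ∀ k t, (c k • F) t ≤ (1 + κ) * F (t / N k) + (r + κ • F) t := by
    intro k t
    have hFt := hF.profile.nonneg t
    have hFN := hF.profile.nonneg (t / N k)
    simp only [Pi.add_apply, Pi.smul_apply, smul_eq_mul]
    rcases hNc k with ⟨hk, hck⟩ | hck
    · have := (hdilate (N k) ⟨hk, hN1 k⟩ t).2
      have := mul_le_mul_of_nonneg_right hck hFt
      have := mul_nonneg hκ hFt
      linarith
    · have := mul_le_mul_of_nonneg_right hck hFt
      have := mul_nonneg hκ hFN
      linarith [hr0 t]
  calc fnNorm ι (translateSum d fun k => c k • F)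
      ≤ (1 + κ) * fnNorm ι (translateSum d fun k t => F (t / N k)) + n * fnNorm ι (r + κ • F) :=
        hι.fnNorm_translateSum_le_of_le hd (fun k => hF.profile.bddSupp.const_smul _)
          (fun k => hF.bddSupp_dilate (hN0 k)) (hr.add (hF.profile.bddSupp.const_smul κ))
          (by linarith) (fun k t => mul_nonneg (hc0 k) (hF.profile.nonneg t)) hpointwise
    _ ≤ (1 + κ) * fnNorm ι F + n * ((κ + κ) * fnNorm ι F) := by
        rw [hι.fnNorm_translateSum_dilate hd hF.profile.bddSupp hFd hN0 hN]
        gcongr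
        exact hF.fnNorm_add_smul_le hι hr hrF hκ
    _ = (1 + κ + 2 * n * κ) * fnNorm ι F := by ring

lemma le_fnNorm_translateSum (hη1 : η ≤ 1) (hκ1 : κ ≤ 1) (hηκ : η ^ θ ≤ κ)
    (hNc : ∀ k, η ≤ N k → N k ^ θ ≤ c k) :
    fnNorm ι F ≤ (1 + κ) * fnNorm ι (translateSum d fun k => c k • F) +
      3 * n * κ * fnNorm ι F := by
  obtain ⟨r, hr, -, hrF, hdilate⟩ := hF.dilate
  have hN1 : ∀ k, N k ≤ 1 := fun k => hN ▸ Finset.single_le_sum (fun j _ => hN0 j)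
    (Finset.mem_univ k)
  have hpointwise : ∀ k t, F (t / N k) ≤ (1 + κ) * (c k • F) t + (r + (2 * κ) • F) t := by
    intro k t
    have hFt := hF.profile.nonneg t
    have hcF := mul_nonneg (hc0 k) hFt
    simp only [Pi.add_apply, Pi.smul_apply, smul_eq_mul]
    rcases le_or_gt η (N k) with hk | hk
    · have hle := (hdilate (N k) ⟨hk, hN1 k⟩ t).1
      have : (1 + κ) * (N k ^ θ * F t) ≤ (1 + κ) * (c k * F t) := by
        gcongr
        exact hNc k hk
      nlinarith [mul_nonneg hκ hFt]
    · have hη := (hN0 k).trans_lt hk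
      have hle := (hF.profile.apply_div_le_apply_div (hN0 k) hk.le t).trans
        (hdilate η ⟨le_rfl, hη1⟩ t).1
      have : (1 + κ) * (η ^ θ * F t) ≤ 2 * (κ * F t) := by
        gcongr
        linarith
      nlinarith [mul_nonneg hκ hcF]
  calc fnNorm ι F = fnNorm ι (translateSum d fun k t => F (t / N k)) :=
        (hι.fnNorm_translateSum_dilate hd hF.profile.bddSupp hFd hN0 hN).symm
    _ ≤ (1 + κ) * fnNorm ι (translateSum d fun k => c k • F) + n * fnNorm ι (r + (2 * κ) • F) :=
        hι.fnNorm_translateSum_le_of_le hd (fun k => hF.bddSupp_dilate (hN0 k))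
          (fun k => hF.profile.bddSupp.const_smul _)
          (hr.add (hF.profile.bddSupp.const_smul (2 * κ))) (by linarith)
          (fun k t => hF.profile.nonneg _) hpointwise
    _ ≤ (1 + κ) * fnNorm ι (translateSum d fun k => c k • F) +
          n * ((κ + 2 * κ) * fnNorm ι F) := by
        gcongr
        exact hF.fnNorm_add_smul_le hι hr hrF (by positivity)
    _ = _ := by ring

end Bounds

variable {n : ℕ} {p : ENNReal} [Fact (1 ≤ p)] {η κ d : ℝ} {F : ℝ → ℝ}

lemma abs_fnNorm_translateSum_sub_le_top (hι : IsRISpace ι) (hF : AlmostHomogeneous ι 0 η κ F)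
    (hκ : 0 ≤ κ) (hηn : η ≤ (n : ℝ)⁻¹) (hd : 0 ≤ d) (hFd : Function.support F ⊆ Set.Ioo 0 d)
    {c : Fin n → ℝ} (hc0 : ∀ k, 0 ≤ c k) (hc : ‖WithLp.toLp ⊤ c‖ = 1) :
    |fnNorm ι (translateSum d fun k => c k • F) - fnNorm ι F| ≤
      (1 + 2 * n) * κ * fnNorm ι F := by
  obtain ⟨j, hj⟩ := exists_eq_one_of_norm_toLp_top hc0 hc
  have hn : (n : ℝ) ≠ 0 := Nat.cast_ne_zero.2 fun hn => (Fin.cast hn j).elim0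
  have hb := fun k => hF.profile.bddSupp.const_smul (c k)
  have hupper := hF.fnNorm_translateSum_le hι hκ hd hFd (N := fun _ => (n : ℝ)⁻¹)
    (fun _ => by positivity) (by simp [hn]) hc0
    fun k => .inl
      ⟨hηn, by simpa [hc] using (le_abs_self _).trans (abs_apply_le_norm_toLp (p := ⊤) c k)⟩
  have hlower : fnNorm ι F ≤ fnNorm ι (translateSum d fun k => c k • F) := by
    have hjd : 0 ≤ (j : ℝ) * d := by positivity
    rw [← hι.fnNorm_shift hF.profile.bddSupp hjd]
    refine hι.fnNorm_mono_of_nonneg (hF.profile.bddSupp.shift hjd) (.translateSum hd hb)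
      (fun t => hF.profile.nonneg _) fun t _ => ?_
    rw [translateSum_apply]
    refine le_trans ?_ (Finset.single_le_sum
      (fun k _ => mul_nonneg (hc0 k) (hF.profile.nonneg (t - k * d))) (Finset.mem_univ j))
    rw [hj, one_mul]
  rw [abs_of_nonneg (sub_nonneg.2 hlower)]
  linarith

lemma abs_fnNorm_translateSum_sub_le_of_ne_top (hι : IsRISpace ι) (hp : p ≠ ⊤)
    (hF : AlmostHomogeneous ι p.toReal⁻¹ η κ F) (hη1 : η ≤ 1) (hκ : 0 ≤ κ)
    (hκn : (1 + 2 * n) * κ ≤ 1) (hηκ : η ^ p.toReal⁻¹ ≤ κ) (hd : 0 ≤ d)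
    (hFd : Function.support F ⊆ Set.Ioo 0 d) {c : Fin n → ℝ} (hc0 : ∀ k, 0 ≤ c k)
    (hc : ‖WithLp.toLp p c‖ = 1) :
    |fnNorm ι (translateSum d fun k => c k • F) - fnNorm ι F| ≤
      (2 + 3 * n) * κ * fnNorm ι F := by
  set X := fnNorm ι (translateSum d fun k => c k • F)
  have hp0 : 0 < p.toReal := ENNReal.toReal_pos (zero_lt_one.trans_le (Fact.out : 1 ≤ p)).ne' hp
  have hN0 : ∀ k, 0 ≤ c k ^ p.toReal := fun k => Real.rpow_nonneg (hc0 k) _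
  have hroot : ∀ k, (c k ^ p.toReal) ^ p.toReal⁻¹ = c k := fun k =>
    Real.rpow_rpow_inv (hc0 k) hp0.ne'
  have hsum := sum_rpow_eq_one_of_norm_toLp hp hc0 hc
  have hupper : X ≤ (1 + κ + 2 * n * κ) * fnNorm ι F := by
    refine hF.fnNorm_translateSum_le hι hκ hd hFd hN0 hsum hc0 fun k => ?_
    rcases le_or_gt η (c k ^ p.toReal) with hk | hk
    · exact .inl ⟨hk, (hroot k).ge⟩
    · refine .inr ((hroot k).symm.trans_le (le_trans ?_ hηκ))
      exact Real.rpow_le_rpow (hN0 k) hk.le (inv_nonneg.2 hp0.le)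
  have hκ1 : κ ≤ 1 := by nlinarith [mul_nonneg n.cast_nonneg hκ]
  have hlower : fnNorm ι F ≤ (1 + κ) * X + 3 * n * κ * fnNorm ι F :=
    hF.le_fnNorm_translateSum hι hκ hd hFd hN0 hsum hc0 hη1 hκ1 hηκ fun k _ => (hroot k).le
  have hX : X ≤ 2 * fnNorm ι F :=
    hupper.trans (mul_le_mul_of_nonneg_right (by linarith) hF.fnNorm_pos.le)
  have hκX := mul_le_mul_of_nonneg_left hX hκ
  have hnκ : 0 ≤ (1 + n) * κ * fnNorm ι F := by
    have := hF.fnNorm_pos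
    positivity
  rw [abs_le]
  constructor <;> linarith

end AlmostHomogeneous

variable {n : ℕ} {p : ENNReal} [Fact (1 ≤ p)] {d ε W : ℝ} {F g : ℝ → ℝ}

lemma IsRISpace.fnNorm_translateSum_abs_smul (hι : IsRISpace ι) (hd : 0 ≤ d) (hF : BddSupp F)
    (hFd : Function.support F ⊆ Set.Ico 0 d) (c : Fin n → ℝ) :
    fnNorm ι (translateSum d fun k => |c k| • F) = fnNorm ι (translateSum d fun k => c k • F) := by
  have hsupp (b : Fin n → ℝ) (k : Fin n) : Function.support (b k • F) ⊆ Set.Ico 0 d :=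
    (Function.support_const_smul_subset _ F).trans hFd
  refine hι.fnNorm_eq_of_distribution_eq (.translateSum hd fun k => hF.const_smul _)
    (.translateSum hd fun k => hF.const_smul _) fun τ _ => ?_
  simp only [distribution, abs_translateSum (hsupp _), Pi.smul_apply, smul_eq_mul, abs_mul, abs_abs]

lemma IsRISpace.spansLp_of_nonneg_of_norm_eq_one (hι : IsRISpace ι) (hd : 0 ≤ d) (hF : BddSupp F)
    (hFd : Function.support F ⊆ Set.Ico 0 d)
    (h : ∀ c : Fin n → ℝ, (∀ k, 0 ≤ c k) → ‖WithLp.toLp p c‖ = 1 →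
      |fnNorm ι (translateSum d fun k => c k • F) - W| ≤ ε * W) :
    SpansLp ι p n d ε W F := by
  intro c
  set s := ‖WithLp.toLp p c‖
  have hs : 0 ≤ s := norm_nonneg _
  have hcs : ∀ k, |c k| = s * (s⁻¹ * |c k|) := fun k => by
    rcases hs.eq_or_lt with h0 | h0
    · have := abs_apply_le_norm_toLp (p := p) c k
      rw [← h0, zero_mul]
      linarith [abs_nonneg (c k)]
    · rw [mul_inv_cancel_left₀ h0.ne']
  have hhom : fnNorm ι (translateSum d fun k => c k • F) =
      s * fnNorm ι (translateSum d fun k => (s⁻¹ * |c k|) • F) := by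
    rw [← hι.fnNorm_translateSum_abs_smul hd hF hFd, ← abs_of_nonneg hs,
      ← hι.fnNorm_const_smul (.translateSum hd fun k => hF.const_smul _), ← translateSum_smul,
      abs_of_nonneg hs]
    simp only [smul_smul, ← hcs]
  rcases hs.eq_or_lt with h0 | h0
  · simp [hhom, ← h0]
  have hunit : ‖WithLp.toLp p fun k => s⁻¹ * |c k|‖ = 1 := by
    have hsmul : (WithLp.toLp p fun k => s⁻¹ * |c k|) = s⁻¹ • WithLp.toLp p fun k => |c k| := rfl
    rw [hsmul, norm_smul, norm_toLp_abs, Real.norm_of_nonneg (inv_nonneg.2 hs),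
      inv_mul_cancel₀ h0.ne']
  rw [hhom, mul_comm W, ← mul_sub, abs_mul, abs_of_nonneg hs, mul_left_comm]
  exact mul_le_mul_of_nonneg_left (h _ (fun k => by positivity) hunit) hs

lemma SpansLp.add (hι : IsRISpace ι) (h : SpansLp ι p n d ε W F) (hd : 0 ≤ d) (hF : BddSupp F)
    (hg : BddSupp g) {ρ : ℝ} (hgW : fnNorm ι g ≤ ρ * W) :
    SpansLp ι p n d (ε + n * ρ) W (F + g) := by
  intro c
  have hbF := fun k => hF.const_smul (c k)
  have hbg := fun k => hg.const_smul (c k)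
  have hsmall : fnNorm ι (translateSum d fun k => c k • g) ≤ n * ρ * (W * ‖WithLp.toLp p c‖) :=
    calc fnNorm ι (translateSum d fun k => c k • g)
        ≤ ∑ k, fnNorm ι (c k • g) := hι.fnNorm_translateSum_le hd hbg
      _ ≤ ∑ _k : Fin n, ‖WithLp.toLp p c‖ * (ρ * W) := Finset.sum_le_sum fun k _ => by
          rw [hι.fnNorm_const_smul hg]
          exact mul_le_mul (abs_apply_le_norm_toLp c k) hgW (fnNorm_nonneg ι g) (norm_nonneg _)
      _ = n * ρ * (W * ‖WithLp.toLp p c‖) := by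
          rw [Finset.sum_const, Finset.card_univ, Fintype.card_fin, nsmul_eq_mul]
          ring
  have hdiff := hι.abs_fnNorm_add_sub_le (BddSupp.translateSum hd hbF) (.translateSum hd hbg)
  rw [← translateSum_add] at hdiff
  simp only [smul_add]
  rw [add_mul]
  exact (abs_sub_le _ (fnNorm ι (translateSum d fun k => c k • F)) _).trans (by
    linarith [h c])

lemma SpansLp.mono (h : SpansLp ι p n d ε W F) (hW : 0 ≤ W) {ε' : ℝ} (hε : ε ≤ ε') :
    SpansLp ι p n d ε' W F := fun c =>
  (h c).trans (mul_le_mul_of_nonneg_right hε (mul_nonneg hW (norm_nonneg _)))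

lemma IsRISpace.exists_spansLp (hι : IsRISpace ι)
    (hpeaks : HasDampedPeaks (fun t => fnNorm ι (chi t)) p.toReal⁻¹) (n : ℕ) (hε : 0 < ε) :
    ∃ F, ∃ D : ℕ, DecreasingProfile F ∧ 0 < fnNorm ι F ∧ Function.support F ⊆ Set.Ioo 0 (D : ℝ) ∧
      SpansLp ι p n D ε (fnNorm ι F) F := by
  set κ : ℝ := min ε 1 / (2 + 3 * n)
  have hn : (0 : ℝ) < 2 + 3 * n := by positivity
  have hκ : 0 < κ := by positivity
  have hκε : (2 + 3 * n) * κ = min ε 1 := mul_div_cancel₀ _ hn.ne'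
  have hnκ : 0 ≤ (1 + n) * κ := by positivity
  have hκn : (1 + 2 * n) * κ ≤ min ε 1 := by linarith
  set η : ℝ := min (n + 1 : ℝ)⁻¹ (κ ^ p.toReal)
  have hη : 0 < η := by positivity
  have hη1 : η ≤ 1 := (min_le_left _ _).trans (inv_le_one_of_one_le₀ (by simp))
  obtain ⟨F, hF⟩ := hι.exists_almostHomogeneous (by positivity) hpeaks hη hη1 hκ
  obtain ⟨B, hB⟩ := hF.profile.bddSupp.support_subset
  obtain ⟨D, hD⟩ := exists_nat_ge B
  have hFd : Function.support F ⊆ Set.Ioo 0 (D : ℝ) := fun t ht =>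
    ⟨hF.profile.support_subset ht, (hB ht).2.trans_le hD⟩
  refine ⟨F, D, hF.profile, hF.fnNorm_pos, hFd, ?_⟩
  refine hι.spansLp_of_nonneg_of_norm_eq_one D.cast_nonneg hF.profile.bddSupp
    (hFd.trans Set.Ioo_subset_Ico_self) fun c hc0 hc => ?_
  have hW := hF.fnNorm_pos.le
  rcases eq_or_ne p ⊤ with rfl | hp
  · rw [ENNReal.toReal_top, inv_zero] at hF
    have hηn : η ≤ (n : ℝ)⁻¹ := by
      rcases n.eq_zero_or_pos with rfl | hn0
      · obtain ⟨j, -⟩ := exists_eq_one_of_norm_toLp_top hc0 hc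
        exact j.elim0
      · exact (min_le_left _ _).trans (inv_anti₀ (by exact_mod_cast hn0) (by simp))
    exact (hF.abs_fnNorm_translateSum_sub_le_top hι hκ.le hηn D.cast_nonneg hFd hc0 hc).trans
      (mul_le_mul_of_nonneg_right (hκn.trans (min_le_left _ _)) hW)
  · have hp0 : p.toReal ≠ 0 :=
      (ENNReal.toReal_pos (zero_lt_one.trans_le (Fact.out : 1 ≤ p)).ne' hp).ne'
    have hηκ : η ^ p.toReal⁻¹ ≤ κ :=
      (Real.rpow_le_rpow hη.le (min_le_right _ _) (by positivity)).trans_eq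
        (Real.rpow_rpow_inv hκ.le hp0)
    exact (hF.abs_fnNorm_translateSum_sub_le_of_ne_top hι hp hη1 hκ.le
      (hκn.trans (min_le_right _ _)) hηκ D.cast_nonneg hFd hc0 hc).trans
      (mul_le_mul_of_nonneg_right (hκε.trans_le (min_le_left _ _)) hW)

end SpansLp

/-- `f` is constant on each dyadic interval of length `2 ^ (-l)`. -/
def IsDyadicStep (l : ℕ) (f : ℝ → ℝ) : Prop := ∀ t, f t = f (⌊2 ^ l * t⌋ / 2 ^ l)

/-- The step function taking on each dyadic interval of length `2 ^ (-l)` the value of `F` at the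
right end of the interval. -/
def dyadicApprox (l : ℕ) (F : ℝ → ℝ) (t : ℝ) : ℝ := F ((⌊2 ^ l * t⌋ + 1) / 2 ^ l)

section DyadicStep

variable {l : ℕ} {d : ℝ} {f F : ℝ → ℝ}

lemma IsDyadicStep.const_smul (hf : IsDyadicStep l f) (c : ℝ) : IsDyadicStep l (c • f) :=
  fun t => congrArg (c • ·) (hf t)

lemma IsDyadicStep.shift (hf : IsDyadicStep l f) (m : ℕ) : IsDyadicStep l fun t => f (t - m) := by
  intro t
  have hfloor : ⌊2 ^ l * (t - m)⌋ = ⌊2 ^ l * t⌋ - 2 ^ l * m := by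
    rw [mul_sub, ← Int.floor_sub_intCast]
    push_cast
    rfl
  beta_reduce
  rw [hf, hfloor]
  push_cast
  rw [sub_div, mul_div_cancel_left₀ _ (by positivity)]

lemma isDyadicStep_dyadicApprox (l : ℕ) (F : ℝ → ℝ) : IsDyadicStep l (dyadicApprox l F) := by
  intro t
  rw [dyadicApprox, dyadicApprox, mul_div_cancel₀ _ (by positivity), Int.floor_intCast]

lemma lt_dyadic_right (l : ℕ) (t : ℝ) : t < (⌊2 ^ l * t⌋ + 1) / 2 ^ l := by
  rw [lt_div_iff₀ (by positivity), mul_comm]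
  exact Int.lt_floor_add_one _

lemma dyadic_right_le (l : ℕ) (t : ℝ) : (⌊2 ^ l * t⌋ + 1) / 2 ^ l ≤ t + 1 / 2 ^ l := by
  rw [add_div]
  gcongr
  rw [div_le_iff₀ (by positivity), mul_comm t]
  exact Int.floor_le _

lemma support_dyadicApprox_subset (hFd : Function.support F ⊆ Set.Ioo 0 d) :
    Function.support (dyadicApprox l F) ⊆ Set.Ico 0 d := by
  intro t ht
  obtain ⟨hpos, hlt⟩ := hFd ht
  refine ⟨?_, (lt_dyadic_right l t).trans hlt⟩
  have hfloor : 0 < ⌊2 ^ l * t⌋ + 1 := by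
    exact_mod_cast (div_pos_iff_of_pos_right (by positivity)).1 hpos
  have := Int.floor_nonneg.1 (Int.lt_add_one_iff.1 hfloor)
  exact nonneg_of_mul_nonneg_right this (by positivity)

lemma BddSupp.dyadicApprox (hF : BddSupp F) (hFd : Function.support F ⊆ Set.Ioo 0 d) :
    BddSupp (dyadicApprox l F) := by
  obtain ⟨C, hC⟩ := hF.bounded
  refine ⟨hF.measurable.comp ?_, ⟨C, fun t => hC _⟩, d, support_dyadicApprox_subset hFd⟩
  have hfloor : Measurable fun t : ℝ => (⌊2 ^ l * t⌋ : ℝ) :=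
    measurable_from_top.comp (Int.measurable_floor.comp (measurable_const_mul _))
  exact (hfloor.add_const 1).div_const _

variable {E : Type*} [NormedAddCommGroup E] [NormedSpace ℝ E] {ι : E →ₗ[ℝ] S}

lemma IsRISpace.exists_fnNorm_dyadicApprox_sub_le (hι : IsRISpace ι) (hF : BddSupp F)
    (hFd : Function.support F ⊆ Set.Ioo 0 d) {K : NNReal} (hK : LipschitzOnWith K F (Set.Ioi 0))
    {δ : ℝ} (hδ : 0 < δ) : ∃ l, fnNorm ι (dyadicApprox l F - F) ≤ δ := by
  obtain ⟨l, hl⟩ := pow_unbounded_of_one_lt (K * fnNorm ι (chi d) / δ) one_lt_two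
  refine ⟨l, ?_⟩
  have hpow : (0 : ℝ) < 2 ^ l := by positivity
  have hclose : ∀ t, 0 < t → |(dyadicApprox l F - F) t| ≤ |((K / 2 ^ l : ℝ) • chi d) t| := by
    intro t ht
    have hright := lt_dyadic_right l t
    rw [Pi.sub_apply, Pi.smul_apply, dyadicApprox]
    rcases lt_or_ge t d with htd | htd
    · have hdist := hK.dist_le_mul _ (ht.trans hright) t ht
      rw [Real.dist_eq, Real.dist_eq, abs_of_pos (sub_pos.2 hright)] at hdist
      rw [chi_of_mem ⟨ht, htd⟩, smul_eq_mul, mul_one,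
        abs_of_nonneg (by positivity : 0 ≤ (K : ℝ) / 2 ^ l)]
      refine hdist.trans ((mul_le_mul_of_nonneg_left ?_ K.coe_nonneg).trans_eq (mul_one_div _ _))
      exact sub_left_le_of_le_add (dyadic_right_le l t)
    · have hzero {s : ℝ} (hs : d ≤ s) : F s = 0 :=
        Function.notMem_support.1 fun hmem => (hFd hmem).2.not_ge hs
      rw [hzero htd, hzero (htd.trans hright.le), sub_zero, abs_zero]
      exact abs_nonneg _
  calc fnNorm ι (dyadicApprox l F - F) ≤ fnNorm ι ((K / 2 ^ l : ℝ) • chi d) :=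
        hι.fnNorm_mono ((hF.dyadicApprox hFd).sub hF) (.const_smul (.chi d) _) hclose
    _ = K * fnNorm ι (chi d) / 2 ^ l := by
        rw [hι.fnNorm_const_smul (.chi d), abs_of_nonneg (by positivity), div_mul_eq_mul_div]
    _ ≤ δ := by
        rw [div_lt_iff₀ hδ] at hl
        rw [div_le_iff₀' hpow]
        exact hl.le

lemma IsRISpace.exists_isDyadicStep_spansLp (hι : IsRISpace ι) {p : ENNReal} [Fact (1 ≤ p)]
    (hpeaks : HasDampedPeaks (fun t => fnNorm ι (chi t)) p.toReal⁻¹) (n : ℕ) {ε : ℝ} (hε : 0 < ε) :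
    ∃ f, ∃ l D : ℕ, BddSupp f ∧ IsDyadicStep l f ∧ Function.support f ⊆ Set.Ico 0 (D : ℝ) ∧
      SpansLp ι p n D ε 1 f := by
  obtain ⟨F, D, hF, hW, hFd, hspan⟩ := hι.exists_spansLp hpeaks n (half_pos hε)
  obtain ⟨K, hK⟩ := hF.lipschitzOn
  set W := fnNorm ι F
  set ρ : ℝ := ε / (2 * (n + 1))
  have hnρ : n * ρ ≤ ε / 2 := by
    rw [show ε / 2 = (n + 1) * ρ by simp only [ρ]; field_simp]
    gcongr
    linarith
  obtain ⟨l, hl⟩ := hι.exists_fnNorm_dyadicApprox_sub_le hF.bddSupp hFd hK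
    (by positivity : 0 < ρ * W)
  have hb : BddSupp (dyadicApprox l F) := hF.bddSupp.dyadicApprox hFd
  refine ⟨W⁻¹ • dyadicApprox l F, l, D, hb.const_smul _,
    (isDyadicStep_dyadicApprox l F).const_smul _,
    (Function.support_const_smul_subset _ _).trans (support_dyadicApprox_subset hFd), ?_⟩
  have hadd := hspan.add hι D.cast_nonneg hF.bddSupp (hb.sub hF.bddSupp) hl
  rw [add_sub_cancel] at hadd
  exact (hadd.normalize hι D.cast_nonneg hb hW).mono zero_le_one (by linarith)

end DyadicStep

/-- The span of the characteristic functions of the dyadic intervals of length `2 ^ (-l)`. -/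
def dyadicSpan (l : ℕ) : Submodule ℝ S := Submodule.span ℝ (Set.range (dyadicChar l))

lemma dyadicChar_ae_eq (l j : ℕ) : dyadicChar l j =ᵐ[mPos]
    (Set.Ico ((j : ℝ) / 2 ^ l) ((j + 1) / 2 ^ l)).indicator fun _ => 1 :=
  AEEqFun.coeFn_mk _ _

lemma dyadicChar_eq_add (l j : ℕ) :
    dyadicChar l j = dyadicChar (l + 1) (2 * j) + dyadicChar (l + 1) (2 * j + 1) := by
  apply AEEqFun.ext
  refine (dyadicChar_ae_eq l j).trans (.trans ?_ (AEEqFun.coeFn_add _ _).symm)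
  refine .trans (.of_eq ?_) ((dyadicChar_ae_eq _ _).add (dyadicChar_ae_eq _ _)).symm
  have hleft : ((2 * j : ℕ) : ℝ) / 2 ^ (l + 1) = j / 2 ^ l := by
    push_cast
    rw [pow_succ', mul_div_mul_left _ _ two_ne_zero]
  have hmid : (((2 * j : ℕ) : ℝ) + 1) / 2 ^ (l + 1) = ((2 * j + 1 : ℕ) : ℝ) / 2 ^ (l + 1) := by
    push_cast
    rfl
  have hright : (((2 * j + 1 : ℕ) : ℝ) + 1) / 2 ^ (l + 1) = (j + 1) / 2 ^ l := by
    push_cast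
    rw [pow_succ', add_assoc, one_add_one_eq_two, ← mul_add_one, mul_div_mul_left _ _ two_ne_zero]
  have hle_mid : (j : ℝ) / 2 ^ l ≤ ((2 * j + 1 : ℕ) : ℝ) / 2 ^ (l + 1) := by
    rw [← hleft]
    gcongr
    omega
  have hmid_le : ((2 * j + 1 : ℕ) : ℝ) / 2 ^ (l + 1) ≤ (j + 1) / 2 ^ l := by
    rw [← hright]
    gcongr
    exact le_add_of_nonneg_right zero_le_one
  rw [hleft, hmid, hright, ← Set.Ico_union_Ico_eq_Ico hle_mid hmid_le,
    Set.indicator_union_of_disjoint (Set.Ico_disjoint_Ico_same)]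
  rfl

lemma dyadicSpan_mono : Monotone dyadicSpan := by
  refine monotone_nat_of_le_succ fun l => Submodule.span_le.2 ?_
  rintro _ ⟨j, rfl⟩
  rw [dyadicChar_eq_add]
  exact add_mem (Submodule.subset_span ⟨_, rfl⟩) (Submodule.subset_span ⟨_, rfl⟩)

lemma mem_dyadic_iff {l j : ℕ} {t : ℝ} (ht : 0 ≤ t) :
    t ∈ Set.Ico ((j : ℝ) / 2 ^ l) ((j + 1) / 2 ^ l) ↔ ⌊2 ^ l * t⌋₊ = j := by
  have hpow : (0 : ℝ) < 2 ^ l := by positivity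
  rw [Nat.floor_eq_iff (by positivity), Set.mem_Ico, div_le_iff₀ hpow, lt_div_iff₀ hpow,
    mul_comm t]

lemma IsDyadicStep.mem_dyadicSpan {l : ℕ} {f : ℝ → ℝ} (hf : IsDyadicStep l f) (hb : BddSupp f)
    {x : S} (hx : x =ᵐ[mPos] f) : x ∈ dyadicSpan l := by
  obtain ⟨B, hB⟩ := hb.support_subset
  set K := ⌈2 ^ l * B⌉₊
  have hsum : x = ∑ j ∈ Finset.range K, f (j / 2 ^ l) • dyadicChar l j := by
    apply AEEqFun.ext
    have hrepr := repr_sum (ι := LinearMap.id) (Finset.range K) fun j _ =>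
      repr_smul (ι := LinearMap.id) (u := dyadicChar l j) (dyadicChar_ae_eq l j) (f (j / 2 ^ l))
    rw [LinearMap.id_apply] at hrepr
    filter_upwards [hx, ae_mPos_pos, hrepr] with t hxt ht hsum
    have hfloor : f t = f (⌊2 ^ l * t⌋₊ / 2 ^ l) := by
      rw [hf, ← natCast_floor_eq_intCast_floor (by positivity)]
    rw [hxt, hsum, Finset.sum_apply, Finset.sum_eq_single ⌊2 ^ l * t⌋₊]
    · rw [Pi.smul_apply, Set.indicator_of_mem ((mem_dyadic_iff ht.le).2 rfl), smul_eq_mul, mul_one,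
        hfloor]
    · intro j _ hj
      rw [Pi.smul_apply, Set.indicator_of_notMem fun hm => hj ((mem_dyadic_iff ht.le).1 hm).symm,
        smul_zero]
    · intro hK
      have hzero : f t = 0 := Function.notMem_support.1 fun hmem => hK <| Finset.mem_range.2 <|
        (Nat.floor_lt (by positivity)).2 <| lt_of_lt_of_le
          (mul_lt_mul_of_pos_left (hB hmem).2 (by positivity)) (Nat.le_ceil _)
      rw [Pi.smul_apply, ← hfloor, hzero, zero_smul]
  rw [hsum]
  exact sum_mem fun j _ => Submodule.smul_mem _ _ (Submodule.subset_span ⟨j, rfl⟩)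

lemma dyadicSpan_le_span_tail (e : ℕ ≃ ℕ × ℕ) (l m : ℕ) : dyadicSpan l ≤
    Submodule.span ℝ ((fun i => dyadicChar (e i).1 (e i).2) '' Set.Ici m) := by
  set L := l + ∑ i ∈ Finset.range m, ((e i).1 + 1)
  refine (dyadicSpan_mono (Nat.le_add_right l _ : l ≤ L)).trans (Submodule.span_le.2 ?_)
  rintro _ ⟨j, rfl⟩
  refine Submodule.subset_span ⟨e.symm (L, j), ?_, by simp only [Equiv.apply_symm_apply, L]⟩
  by_contra hlt
  have hle := Finset.single_le_sum (f := fun i => (e i).1 + 1) (fun _ _ => Nat.zero_le _)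
    (Finset.mem_range.2 (not_le.1 hlt))
  simp only [Equiv.apply_symm_apply] at hle
  omega

section Blocks

variable {V : Type*} [AddCommGroup V] [Module ℝ V] {z : ℕ → V}

lemma exists_eq_sum_Ico_of_mem_span_tail {x : V} {m : ℕ}
    (hx : x ∈ Submodule.span ℝ (z '' Set.Ici m)) :
    ∃ (m' : ℕ) (α : ℕ → ℝ), m < m' ∧ x = ∑ i ∈ Finset.Ico m m', α i • z i := by
  obtain ⟨α, hα, rfl⟩ := (Finsupp.mem_span_image_iff_linearCombination ℝ).1 hx
  refine ⟨max (m + 1) (α.support.sup id + 1), α, lt_max_of_lt_left m.lt_succ_self, ?_⟩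
  refine Finsupp.sum_of_support_subset α (fun i hi => Finset.mem_Ico.2 ⟨hα hi, ?_⟩) _
    fun i _ => zero_smul ℝ (z i)
  exact lt_max_of_lt_right (Nat.lt_succ_of_le (Finset.le_sup (f := id) hi))

lemma exists_successive_blocks {g : ℕ → V}
    (h : ∀ k m, g k ∈ Submodule.span ℝ (z '' Set.Ici m)) :
    ∃ (M : ℕ → ℕ) (α : ℕ → ℝ), M 0 = 0 ∧ StrictMono M ∧
      ∀ k, g k = ∑ i ∈ Finset.Ico (M k) (M (k + 1)), α i • z i := by
  choose next coef hlt hsum using fun k m => exists_eq_sum_Ico_of_mem_span_tail (h k m)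
  let M : ℕ → ℕ := fun k => Nat.rec (motive := fun _ => ℕ) 0 next k
  have hM : StrictMono M := strictMono_nat_of_lt_succ fun k => hlt k (M k)
  let block : ℕ → ℕ := fun i => Nat.findGreatest (fun k => M k ≤ i) i
  refine ⟨M, fun i => coef (block i) (M (block i)) i, rfl, hM, fun k => ?_⟩
  rw [hsum k (M k)]
  refine Finset.sum_congr rfl fun i hi => ?_
  obtain ⟨hki, hik⟩ := Finset.mem_Ico.1 hi
  have hblock : block i = k := by
    refine Nat.findGreatest_eq_iff.2 ⟨(hM.id_le k).trans hki, fun _ => hki, fun j hj _ => ?_⟩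
    exact not_le.2 (hik.trans_le (hM.monotone hj))
  simp only [hblock]

end Blocks

section BlockRepresentation

variable {E : Type*} [NormedAddCommGroup E] [NormedSpace ℝ E] {ι : E →ₗ[ℝ] S}

lemma SpansLp.inv_mul_le_norm_sum {p : ENNReal} [Fact (1 ≤ p)] {n : ℕ} {d ε : ℝ} {f : ℝ → ℝ}
    (hf : SpansLp ι p n d (ε / (1 + ε)) 1 f) (hι : IsRISpace ι) (hε : 0 < ε) {u : Fin n → E}
    (hu : ∀ k : Fin n, ι (u k) =ᵐ[mPos] fun t => f (t - k * d)) (a : Fin n → ℝ) :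
    (1 + ε)⁻¹ * ‖WithLp.toLp p a‖ ≤ ‖∑ k, a k • u k‖ ∧
      ‖∑ k, a k • u k‖ ≤ (1 + ε) * ‖WithLp.toLp p a‖ := by
  have hrepr : ι (∑ k, a k • u k) =ᵐ[mPos] translateSum d fun k => a k • f :=
    repr_sum Finset.univ fun k _ => repr_smul (hu k) (a k)
  have hspan := hf a
  rw [hι.fnNorm_eq hrepr, one_mul, abs_le] at hspan
  have hinv : (1 + ε)⁻¹ = 1 - ε / (1 + ε) := by
    field_simp
    ring
  have hle : ε / (1 + ε) ≤ ε := div_le_self hε.le (by linarith)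
  have := mul_le_mul_of_nonneg_right hle (norm_nonneg (WithLp.toLp p a))
  rw [hinv]
  constructor <;> linarith [hspan.1, hspan.2]

theorem IsRISpace.symmetricallyBlockFinitelyRepresented (hι : IsRISpace ι) {p : ENNReal}
    [Fact (1 ≤ p)] (hpeaks : HasDampedPeaks (fundamentalFunction ι) p.toReal⁻¹)
    (e : ℕ ≃ ℕ × ℕ) :
    SymmetricallyBlockFinitelyRepresented ι p (fun i => dyadicChar (e i).1 (e i).2) := by
  intro n ε hε
  rw [funext (fundamentalFunction_eq_fnNorm_chi ι)] at hpeaks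
  obtain ⟨f, l, D, hb, hstep, hfD, hspan⟩ := hι.exists_isDyadicStep_spansLp hpeaks n
    (by positivity : 0 < ε / (1 + ε))
  have hshift (k : ℕ) : BddSupp fun t => f (t - k * D) := hb.shift (by positivity)
  choose u hu using fun k => hι.exists_repr (hshift k)
  have hmem : ∀ k, ι (u k) ∈ dyadicSpan l := fun k => by
    refine IsDyadicStep.mem_dyadicSpan ?_ (hshift k) (hu k)
    exact_mod_cast hstep.shift (k * D)
  obtain ⟨M, α, hM0, hM, hblock⟩ :=
    exists_successive_blocks fun k m => dyadicSpan_le_span_tail e l m (hmem k)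
  refine ⟨fun k => M k, α, fun k => u k, hM0, fun i j hij => hM hij, fun k => hblock k,
    fun j k hjk => ?_, fun j k τ hτ => ?_,
    hspan.inv_mul_le_norm_sum hι hε fun k => hu k⟩
  · filter_upwards [hu j, hu k] with t hj hk
    rw [hj, hk]
    by_contra! hne
    exact hjk (eq_of_mem_support_translate hfD hfD hne.1 hne.2)
  · have hdistrib (k : ℕ) : distrib (ι (u k)) τ = distribution f τ :=
      (distrib_eq_distribution (hu k) τ).trans
        (distribution_shift hb.support_subset_Ici (by positivity) hτ.le)
    rw [hdistrib, hdistrib]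

end BlockRepresentation

/-- Growth conditions satisfied by the fundamental function of an r.i. space: positivity on
`(0, ∞)`, monotonicity, and at most doubling when the argument is doubled. -/
structure TameGrowth (φ : ℝ → ℝ) : Prop where
  pos : ∀ s, 0 < s → 0 < φ s
  mono : ∀ s t, 0 < s → s ≤ t → φ s ≤ φ t
  two_mul_le : ∀ s, 0 < s → φ (2 * s) ≤ 2 * φ s

lemma IsRISpace.tameGrowth {E : Type*} [NormedAddCommGroup E] [NormedSpace ℝ E] {ι : E →ₗ[ℝ] S}
    (hι : IsRISpace ι) : TameGrowth (fundamentalFunction ι) := by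
  rw [funext (fundamentalFunction_eq_fnNorm_chi ι)]
  exact ⟨fun _ hs => hι.fnNorm_chi_pos hs, fun _ _ _ hst => hι.fnNorm_chi_mono hst,
    fun _ hs => hι.fnNorm_chi_two_mul_le hs.le⟩

namespace TameGrowth

variable {φ : ℝ → ℝ} {r s : ℝ}

lemma two_pow_mul_le (hφ : TameGrowth φ) (n : ℕ) (hs : 0 < s) : φ (2 ^ n * s) ≤ 2 ^ n * φ s := by
  induction n with
  | zero => simp
  | succ n ih =>
    calc φ (2 ^ (n + 1) * s) = φ (2 * (2 ^ n * s)) := by ring_nf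
      _ ≤ 2 * φ (2 ^ n * s) := hφ.two_mul_le _ (by positivity)
      _ ≤ 2 * (2 ^ n * φ s) := by gcongr
      _ = 2 ^ (n + 1) * φ s := by ring

lemma le_two_pow_mul (hφ : TameGrowth φ) (n : ℕ) (hs : 0 < s) : φ s ≤ φ (2 ^ n * s) :=
  hφ.mono _ _ hs (le_mul_of_one_le_left hs.le (one_le_pow₀ one_le_two))

lemma pow_mul_le (hφ : TameGrowth φ) (hr₀ : 0 < r) (hr : r ≤ 2) (n : ℕ) (hs : 0 < s) :
    φ (r ^ n * s) ≤ 2 ^ n * φ s :=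
  (hφ.mono _ _ (by positivity) (by gcongr)).trans (hφ.two_pow_mul_le n hs)

lemma half_pow_mul_le (hφ : TameGrowth φ) (hr : 1 / 2 ≤ r) (n : ℕ) (hs : 0 < s) :
    (1 / 2) ^ n * φ s ≤ φ (r ^ n * s) := by
  have hhalf : 0 < (1 / 2 : ℝ) ^ n * s := by positivity
  have hcancel : (1 / 2 : ℝ) ^ n * 2 ^ n = 1 := by rw [← mul_pow]; norm_num
  calc (1 / 2) ^ n * φ s = (1 / 2) ^ n * φ (2 ^ n * ((1 / 2) ^ n * s)) := by
        rw [← mul_assoc (2 ^ n), mul_comm (2 ^ n), hcancel, one_mul]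
    _ ≤ (1 / 2) ^ n * (2 ^ n * φ ((1 / 2) ^ n * s)) := by
        gcongr
        exact hφ.two_pow_mul_le n hhalf
    _ = φ ((1 / 2) ^ n * s) := by rw [← mul_assoc, hcancel, one_mul]
    _ ≤ φ (r ^ n * s) := hφ.mono _ _ hhalf (by gcongr)

end TameGrowth

section GrowthRate

variable {m : ℕ → ℝ} {L : ℝ}

lemma exists_tendsto_logb_of_submultiplicative (hsub : ∀ i j, m (i + j) ≤ m i * m j)
    (hlow : ∀ n, (1 / 2 : ℝ) ^ n ≤ m n) :
    ∃ L, Tendsto (fun n : ℕ => 1 / (n : ℝ) * Real.logb 2 (m n)) atTop (𝓝 L) := by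
  have hpos (n : ℕ) : 0 < m n := lt_of_lt_of_le (by positivity) (hlow n)
  have hsubadd : Subadditive fun n => Real.logb 2 (m n) := fun i j => by
    rw [← Real.logb_mul (hpos i).ne' (hpos j).ne']
    exact Real.logb_le_logb_of_le one_lt_two (hpos _) (hsub i j)
  have hbdd : BddBelow (Set.range fun n : ℕ => Real.logb 2 (m n) / n) := by
    refine ⟨-1, ?_⟩
    rintro _ ⟨n, rfl⟩
    rcases Nat.eq_zero_or_pos n with rfl | hn
    · simp
    rw [le_div_iff₀ (by exact_mod_cast hn), Real.le_logb_iff_rpow_le one_lt_two (hpos n),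
      neg_one_mul, Real.rpow_neg two_pos.le, Real.rpow_natCast]
    simpa using hlow n
  refine ⟨_, (hsubadd.tendsto_lim hbdd).congr fun n => ?_⟩
  rw [div_mul_eq_mul_div, one_mul]

lemma le_of_tendsto_logb_of_le_mul_rpow {C x : ℝ} (hpos : ∀ n, 0 < m n)
    (hL : Tendsto (fun n : ℕ => 1 / (n : ℝ) * Real.logb 2 (m n)) atTop (𝓝 L)) (hC : 0 < C)
    (h : ∀ n, m n ≤ C * 2 ^ (n * x)) : L ≤ x := by
  have hx : Tendsto (fun n : ℕ => Real.logb 2 C / (n : ℝ) + x) atTop (𝓝 (0 + x)) :=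
    (tendsto_const_nhds.div_atTop tendsto_natCast_atTop_atTop).add_const x
  rw [zero_add] at hx
  refine le_of_tendsto_of_tendsto hL hx ?_
  filter_upwards [eventually_gt_atTop 0] with n hn
  have hn' : (0 : ℝ) < n := by exact_mod_cast hn
  have hlog : Real.logb 2 (m n) ≤ Real.logb 2 C + n * x := by
    have := Real.logb_le_logb_of_le one_lt_two (hpos n) (h n)
    rwa [Real.logb_mul hC.ne' (by positivity), Real.logb_rpow two_pos (by norm_num)] at this
  rw [div_mul_eq_mul_div, one_mul, div_le_iff₀ hn', add_mul, div_mul_cancel₀ _ hn'.ne']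
  linarith

end GrowthRate

/-- The compatibility between the ranges `T n` of `s` over which a dilation function takes the
supremum of `φ (r ^ n * s) / φ s` that makes this supremum submultiplicative in `n`. -/
structure IsDilationRange (r : ℝ) (T : ℕ → Set ℝ) : Prop where
  pos : ∀ n, ∀ s ∈ T n, 0 < s
  nonempty : ∀ n, (T n).Nonempty
  add : ∀ i j, ∀ s ∈ T (i + j), s ∈ T j ∧ r ^ j * s ∈ T i

lemma isDilationRange_Ioi {r : ℝ} (hr : 0 < r) : IsDilationRange r fun _ => Set.Ioi 0 where
  pos _ _ hs := hs
  nonempty _ := ⟨1, Set.mem_Ioi.2 one_pos⟩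
  add _ j _ hs := ⟨hs, mul_pos (pow_pos hr j) hs⟩

lemma mem_Ioc_min_one_div {r s : ℝ} (hr : 1 ≤ r) (n : ℕ) :
    s ∈ Set.Ioc (0 : ℝ) (min 1 (1 / r ^ n)) ↔ 0 < s ∧ r ^ n * s ≤ 1 := by
  have hrn : 0 < r ^ n := pow_pos (one_pos.trans_le hr) n
  rw [min_eq_right ((div_le_one hrn).2 (one_le_pow₀ hr)), Set.mem_Ioc, le_div_iff₀ hrn, mul_comm]

lemma isDilationRange_Ioc {r : ℝ} (hr : 1 ≤ r) :
    IsDilationRange r fun n => Set.Ioc (0 : ℝ) (min 1 (1 / r ^ n)) where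
  pos _ _ hs := hs.1
  nonempty n := ⟨_, lt_min one_pos (one_div_pos.2 (pow_pos (one_pos.trans_le hr) n)), le_rfl⟩
  add i j s hs := by
    rw [mem_Ioc_min_one_div hr, pow_add, mul_assoc] at hs
    obtain ⟨hs, hle⟩ := hs
    have hjs : 0 < r ^ j * s := mul_pos (pow_pos (one_pos.trans_le hr) j) hs
    exact ⟨(mem_Ioc_min_one_div hr j).2
      ⟨hs, (le_mul_of_one_le_left hjs.le (one_le_pow₀ hr)).trans hle⟩,
      (mem_Ioc_min_one_div hr i).2 ⟨hjs, hle⟩⟩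

lemma mem_Ici_max_one_div {r s : ℝ} (hr₀ : 0 < r) (hr : r ≤ 1) (n : ℕ) :
    s ∈ Set.Ici (max (1 : ℝ) (1 / r ^ n)) ↔ 1 ≤ r ^ n * s := by
  have hrn : 0 < r ^ n := pow_pos hr₀ n
  rw [max_eq_right ((one_le_div hrn).2 (pow_le_one₀ hr₀.le hr)), Set.mem_Ici, div_le_iff₀ hrn,
    mul_comm]

lemma isDilationRange_Ici {r : ℝ} (hr₀ : 0 < r) (hr : r ≤ 1) :
    IsDilationRange r fun n => Set.Ici (max (1 : ℝ) (1 / r ^ n)) where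
  pos _ _ hs := one_pos.trans_le ((le_max_left _ _).trans hs)
  nonempty _ := ⟨_, Set.self_mem_Ici⟩
  add i j s hs := by
    have hs₀ : 0 ≤ s := zero_le_one.trans ((le_max_left _ _).trans hs)
    rw [mem_Ici_max_one_div hr₀ hr, pow_add, mul_assoc] at hs
    exact ⟨(mem_Ici_max_one_div hr₀ hr j).2
      (hs.trans (mul_le_of_le_one_left (by positivity) (pow_le_one₀ hr₀.le hr))),
      (mem_Ici_max_one_div hr₀ hr i).2 hs⟩

/-- The value at `r ^ n` of the dilation function of `φ` with the ranges `T`. -/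
def dilOn (φ : ℝ → ℝ) (r : ℝ) (T : ℕ → Set ℝ) (n : ℕ) : ℝ := ⨆ s : T n, φ (r ^ n * s) / φ s

namespace TameGrowth

section DilOn

variable {φ : ℝ → ℝ} {r L : ℝ} {T : ℕ → Set ℝ}

lemma div_le_dilOn (hφ : TameGrowth φ) (hr₀ : 0 < r) (hr : r ≤ 2) (hT : IsDilationRange r T)
    {n : ℕ} {s : ℝ} (hs : s ∈ T n) : φ (r ^ n * s) / φ s ≤ dilOn φ r T n := by
  have hbdd : BddAbove (Set.range fun s : T n => φ (r ^ n * s) / φ s) := by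
    refine ⟨2 ^ n, ?_⟩
    rintro _ ⟨s, rfl⟩
    have hs := hT.pos n s s.2
    exact (div_le_iff₀ (hφ.pos s hs)).2 (hφ.pow_mul_le hr₀ hr n hs)
  exact le_ciSup hbdd ⟨s, hs⟩

lemma dilOn_le (hφ : TameGrowth φ) (hT : IsDilationRange r T) {n : ℕ} {K : ℝ}
    (h : ∀ s ∈ T n, φ (r ^ n * s) ≤ K * φ s) : dilOn φ r T n ≤ K := by
  have := (hT.nonempty n).to_subtype
  exact ciSup_le fun s => (div_le_iff₀ (hφ.pos s (hT.pos n s s.2))).2 (h s s.2)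

lemma half_pow_le_dilOn (hφ : TameGrowth φ) (hr : r ∈ Set.Icc (1 / 2) 2)
    (hT : IsDilationRange r T) (n : ℕ) : (1 / 2) ^ n ≤ dilOn φ r T n := by
  obtain ⟨s, hs⟩ := hT.nonempty n
  have hs₀ := hT.pos n s hs
  exact ((le_div_iff₀ (hφ.pos s hs₀)).2 (hφ.half_pow_mul_le hr.1 n hs₀)).trans
    (hφ.div_le_dilOn (by linarith [hr.1]) hr.2 hT hs)

lemma dilOn_pos (hφ : TameGrowth φ) (hr : r ∈ Set.Icc (1 / 2) 2) (hT : IsDilationRange r T)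
    (n : ℕ) : 0 < dilOn φ r T n :=
  lt_of_lt_of_le (by positivity) (hφ.half_pow_le_dilOn hr hT n)

lemma dilOn_add_le (hφ : TameGrowth φ) (hr₀ : 0 < r) (hr : r ≤ 2) (hT : IsDilationRange r T)
    (i j : ℕ) : dilOn φ r T (i + j) ≤ dilOn φ r T i * dilOn φ r T j := by
  refine hφ.dilOn_le hT fun s hs => ?_
  obtain ⟨hsj, hsi⟩ := hT.add i j s hs
  have hφs := hφ.pos s (hT.pos _ s hs)
  have hφjs := hφ.pos _ (hT.pos _ _ hsi)
  have hi := hφ.div_le_dilOn hr₀ hr hT hsi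
  have hi₀ : 0 < φ (r ^ i * (r ^ j * s)) := hφ.pos _ (mul_pos (pow_pos hr₀ i) (hT.pos _ _ hsi))
  calc φ (r ^ (i + j) * s)
      = φ (r ^ i * (r ^ j * s)) / φ (r ^ j * s) * (φ (r ^ j * s) / φ s) * φ s := by
        rw [div_mul_div_cancel₀ hφjs.ne', div_mul_cancel₀ _ hφs.ne', pow_add, mul_assoc]
    _ ≤ dilOn φ r T i * dilOn φ r T j * φ s := by
        gcongr
        · exact (div_pos hi₀ hφjs).le.trans hi
        · exact hφ.div_le_dilOn hr₀ hr hT hsj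

lemma exists_tendsto_logb_dilOn (hφ : TameGrowth φ) (hr : r ∈ Set.Icc (1 / 2) 2)
    (hT : IsDilationRange r T) :
    ∃ L, Tendsto (fun n : ℕ => 1 / (n : ℝ) * Real.logb 2 (dilOn φ r T n)) atTop (𝓝 L) :=
  exists_tendsto_logb_of_submultiplicative
    (hφ.dilOn_add_le (by linarith [hr.1]) hr.2 hT) (hφ.half_pow_le_dilOn hr hT)

lemma le_of_tendsto_logb_dilOn (hφ : TameGrowth φ) (hr : r ∈ Set.Icc (1 / 2) 2)
    (hT : IsDilationRange r T)
    (hL : Tendsto (fun n : ℕ => 1 / (n : ℝ) * Real.logb 2 (dilOn φ r T n)) atTop (𝓝 L))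
    {C x : ℝ} (hC : 0 < C) (h : ∀ n, ∀ s ∈ T n, φ (r ^ n * s) ≤ C * 2 ^ (n * x) * φ s) : L ≤ x :=
  le_of_tendsto_logb_of_le_mul_rpow (hφ.dilOn_pos hr hT) hL hC fun n => hφ.dilOn_le hT (h n)

end DilOn

section Index

variable {φ M : ℝ → ℝ} {T : ℕ → Set ℝ} {C x : ℝ}

lemma upperIndex_nonneg (hφ : TameGrowth φ) (hT : IsDilationRange 2 T)
    (hM : ∀ n : ℕ, M (2 ^ n) = dilOn φ 2 T n) : 0 ≤ upperIndex M := by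
  obtain ⟨L, hL⟩ := hφ.exists_tendsto_logb_dilOn (by norm_num) hT
  simp only [upperIndex, hM]
  rw [hL.limUnder_eq]
  refine ge_of_tendsto' hL fun n => mul_nonneg (by positivity) (Real.logb_nonneg one_lt_two ?_)
  obtain ⟨s, hs⟩ := hT.nonempty n
  have hs₀ := hT.pos n s hs
  exact ((one_le_div (hφ.pos s hs₀)).2 (hφ.le_two_pow_mul n hs₀)).trans
    (hφ.div_le_dilOn two_pos le_rfl hT hs)

lemma upperIndex_le (hφ : TameGrowth φ) (hT : IsDilationRange 2 T)
    (hM : ∀ n : ℕ, M (2 ^ n) = dilOn φ 2 T n) (hC : 0 < C)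
    (h : ∀ n : ℕ, ∀ s ∈ T n, φ (2 ^ n * s) ≤ C * (2 ^ n) ^ x * φ s) : upperIndex M ≤ x := by
  have hr : (2 : ℝ) ∈ Set.Icc (1 / 2) 2 := by norm_num
  obtain ⟨L, hL⟩ := hφ.exists_tendsto_logb_dilOn hr hT
  simp only [upperIndex, hM]
  rw [hL.limUnder_eq]
  refine hφ.le_of_tendsto_logb_dilOn hr hT hL hC fun n s hs => ?_
  rw [Real.rpow_mul two_pos.le, Real.rpow_natCast]
  exact h n s hs

lemma le_lowerIndex (hφ : TameGrowth φ) (hT : IsDilationRange (1 / 2) T)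
    (hM : ∀ n : ℕ, M ((1 / 2) ^ n) = dilOn φ (1 / 2) T n) (hC : 0 < C)
    (h : ∀ n : ℕ, ∀ s ∈ T n, φ ((1 / 2) ^ n * s) ≤ C * ((1 / 2) ^ n) ^ x * φ s) :
    x ≤ lowerIndex M := by
  have hr : (1 / 2 : ℝ) ∈ Set.Icc (1 / 2) 2 := by norm_num
  obtain ⟨L, hL⟩ := hφ.exists_tendsto_logb_dilOn hr hT
  have hzpow (n : ℕ) : (2 : ℝ) ^ (-(n : ℤ)) = (1 / 2) ^ n := by
    rw [zpow_neg, zpow_natCast, one_div, inv_pow]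
  simp only [lowerIndex, hzpow, hM]
  rw [hL.limUnder_eq, le_neg]
  refine hφ.le_of_tendsto_logb_dilOn hr hT hL hC fun n s hs => ?_
  have hrpow : (2 : ℝ) ^ ((n : ℝ) * -x) = ((1 / 2) ^ n) ^ x := by
    rw [mul_neg, Real.rpow_neg two_pos.le, Real.rpow_mul two_pos.le, Real.rpow_natCast, one_div,
      inv_pow, Real.inv_rpow (by positivity)]
  rw [hrpow]
  exact h n s hs

lemma nuIndex_nonneg (hφ : TameGrowth φ) : 0 ≤ nuIndex φ :=
  hφ.upperIndex_nonneg (isDilationRange_Ioi two_pos) fun _ => rfl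

lemma nuIndex_le (hφ : TameGrowth φ) (hC : 0 < C)
    (h : ∀ (n : ℕ) s, 0 < s → φ (2 ^ n * s) ≤ C * (2 ^ n) ^ x * φ s) : nuIndex φ ≤ x :=
  hφ.upperIndex_le (isDilationRange_Ioi two_pos) (fun _ => rfl) hC h

lemma nuIndex_le_one (hφ : TameGrowth φ) : nuIndex φ ≤ 1 :=
  hφ.nuIndex_le one_pos fun n s hs => by simpa using hφ.two_pow_mul_le n hs

lemma nuZeroIndex_nonneg (hφ : TameGrowth φ) : 0 ≤ nuZeroIndex φ :=
  hφ.upperIndex_nonneg (isDilationRange_Ioc one_le_two) fun _ => rfl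

lemma nuZeroIndex_le (hφ : TameGrowth φ) (hC : 0 < C)
    (h : ∀ (n : ℕ) s, 0 < s → 2 ^ n * s ≤ 1 → φ (2 ^ n * s) ≤ C * (2 ^ n) ^ x * φ s) :
    nuZeroIndex φ ≤ x :=
  hφ.upperIndex_le (isDilationRange_Ioc one_le_two) (fun _ => rfl) hC fun n s hs =>
    let ⟨hs₀, hle⟩ := (mem_Ioc_min_one_div one_le_two n).1 hs
    h n s hs₀ hle

lemma nuZeroIndex_le_one (hφ : TameGrowth φ) : nuZeroIndex φ ≤ 1 :=
  hφ.nuZeroIndex_le one_pos fun n s hs _ => by simpa using hφ.two_pow_mul_le n hs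

lemma le_muIndex (hφ : TameGrowth φ) (hC : 0 < C)
    (h : ∀ (n : ℕ) s, 0 < s → φ ((1 / 2) ^ n * s) ≤ C * ((1 / 2) ^ n) ^ x * φ s) :
    x ≤ muIndex φ :=
  hφ.le_lowerIndex (isDilationRange_Ioi one_half_pos) (fun _ => rfl) hC h

lemma le_muInftyIndex (hφ : TameGrowth φ) (hC : 0 < C)
    (h : ∀ (n : ℕ) s, 0 < s → 1 ≤ (1 / 2) ^ n * s →
      φ ((1 / 2) ^ n * s) ≤ C * ((1 / 2) ^ n) ^ x * φ s) : x ≤ muInftyIndex φ := by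
  have hT := isDilationRange_Ici one_half_pos one_half_lt_one.le
  exact hφ.le_lowerIndex hT (fun _ => rfl) hC fun n s hs => h n s (hT.pos n s hs)
    ((mem_Ici_max_one_div one_half_pos one_half_lt_one.le n).1 hs)

end Index

end TameGrowth

/-- The function `t ↦ t ^ (-θ) * φ t` decays like `t ^ (-e)` between every point to the left
of `c` and `c`, up to the constant `C`. -/
def DecaysFromLeft (φ : ℝ → ℝ) (θ e C c : ℝ) : Prop :=
  ∀ a, 0 < a → a ≤ c → φ c ≤ C * (c / a) ^ (θ - e) * φ a

/-- The function `t ↦ t ^ (-θ) * φ t` grows like `t ^ e` between `c` and every point to the right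
of `c`, up to the constant `C`. -/
def GrowsToRight (φ : ℝ → ℝ) (θ e C c : ℝ) : Prop :=
  ∀ b, c ≤ b → φ c ≤ C * (c / b) ^ (θ + e) * φ b

lemma div_rpow_sub_mul_rpow_neg {a c : ℝ} (ha : 0 < a) (hc : 0 < c) (θ e : ℝ) :
    (c / a) ^ (θ - e) * c ^ (-θ) = (a / c) ^ e * a ^ (-θ) := by
  rw [Real.rpow_sub (by positivity), Real.div_rpow hc.le ha.le, Real.div_rpow hc.le ha.le,
    Real.div_rpow ha.le hc.le, Real.rpow_neg hc.le, Real.rpow_neg ha.le]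
  field_simp

lemma exists_of_not_hasDampedPeaks {φ : ℝ → ℝ} {θ : ℝ} (h : ¬ HasDampedPeaks φ θ) :
    ∃ e C : ℝ, 0 < e ∧ 0 < C ∧ ∀ c, 0 < c → DecaysFromLeft φ θ e C c ∨ GrowsToRight φ θ e C c := by
  simp only [HasDampedPeaks] at h
  push Not at h
  obtain ⟨e, δ, he, hδ, h⟩ := h
  refine ⟨e, δ⁻¹, he, inv_pos.2 hδ, fun c hc => or_iff_not_imp_left.2 fun hleft b hcb => ?_⟩
  simp only [DecaysFromLeft] at hleft
  push Not at hleft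
  obtain ⟨a, ha, hac, hleft⟩ := hleft
  have hcθ : 0 < c ^ (-θ) := by positivity
  have hdamped : φ a * ((a / c) ^ e * a ^ (-θ)) ≤ δ * (φ c * c ^ (-θ)) := by
    rw [mul_assoc, inv_mul_lt_iff₀ hδ] at hleft
    calc φ a * ((a / c) ^ e * a ^ (-θ)) = (c / a) ^ (θ - e) * φ a * c ^ (-θ) := by
          rw [← div_rpow_sub_mul_rpow_neg ha hc]
          ring
      _ ≤ δ * φ c * c ^ (-θ) := by gcongr
      _ = δ * (φ c * c ^ (-θ)) := mul_assoc _ _ _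
  have hright := h a c b ha hac hcb hdamped
  have hpow := div_rpow_sub_mul_rpow_neg (hc.trans_le hcb) hc θ (-e)
  rw [sub_neg_eq_add, Real.rpow_neg (div_pos (hc.trans_le hcb) hc).le,
    ← Real.inv_rpow (div_pos (hc.trans_le hcb) hc).le, inv_div] at hpow
  rw [← hpow, ← mul_assoc, ← mul_assoc, mul_lt_mul_iff_left₀ hcθ] at hright
  rw [mul_assoc, le_inv_mul_iff₀ hδ]
  linarith

namespace TameGrowth

variable {φ : ℝ → ℝ} {θ e C : ℝ}

lemma exists_le_mul_of_decaysFromLeft_of_growsToRight (hφ : TameGrowth φ) (he : 0 < e)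
    (hC : 0 < C) : ∃ Q, 0 < Q ∧ ∀ l r, 0 < l → 0 < r → DecaysFromLeft φ θ e C l →
      GrowsToRight φ θ e C r → l ≤ Q * r := by
  refine ⟨max 1 ((C * C) ^ (2 * e)⁻¹), by positivity, fun l r hl hr hleft hright => ?_⟩
  rcases le_or_gt l r with hlr | hrl
  · exact hlr.trans (le_mul_of_one_le_left hr.le (le_max_left _ _))
  have hx : 0 < l / r := div_pos hl hr
  have hdecay := hleft r hr hrl.le
  have hgrowth := hright l hrl.le
  rw [← inv_div l r, Real.inv_rpow hx.le, ← Real.rpow_neg hx.le] at hgrowth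
  have hround : 1 * φ l ≤ C * C * (l / r) ^ (-(2 * e)) * φ l := by
    calc 1 * φ l ≤ C * (l / r) ^ (θ - e) * φ r := by rwa [one_mul]
      _ ≤ C * (l / r) ^ (θ - e) * (C * (l / r) ^ (-(θ + e)) * φ l) := by gcongr
      _ = C * C * ((l / r) ^ (θ - e) * (l / r) ^ (-(θ + e))) * φ l := by ring
      _ = C * C * (l / r) ^ (-(2 * e)) * φ l := by
        rw [← Real.rpow_add hx]
        ring_nf
  have hpow := le_of_mul_le_mul_right hround (hφ.pos l hl)
  rw [Real.rpow_neg hx.le, ← div_eq_mul_inv, one_le_div (by positivity),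
    ← Real.le_rpow_inv_iff_of_pos hx.le (by positivity) (by positivity)] at hpow
  exact (div_le_iff₀ hr).1 (hpow.trans (le_max_right _ _))

lemma nuIndex_le_of_decaysFromLeft (hφ : TameGrowth φ) (hC : 0 < C)
    (hleft : ∀ c, 0 < c → DecaysFromLeft φ θ e C c) : nuIndex φ ≤ θ - e := by
  refine hφ.nuIndex_le hC fun n s hs => ?_
  have := hleft (2 ^ n * s) (by positivity) s hs
    (le_mul_of_one_le_left hs.le (one_le_pow₀ one_le_two))
  rwa [mul_div_cancel_right₀ _ hs.ne'] at this

lemma le_muIndex_of_growsToRight (hφ : TameGrowth φ) (hC : 0 < C)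
    (hright : ∀ c, 0 < c → GrowsToRight φ θ e C c) : θ + e ≤ muIndex φ := by
  refine hφ.le_muIndex hC fun n s hs => ?_
  have := hright ((1 / 2) ^ n * s) (by positivity) s
    (mul_le_of_le_one_left hs.le (pow_le_one₀ (by norm_num) (by norm_num)))
  rwa [mul_div_cancel_right₀ _ hs.ne'] at this

lemma nuZeroIndex_le_of_exists_decaysFromLeft (hφ : TameGrowth φ) (he : 0 < e) (hC : 0 < C)
    (h : ∀ c, 0 < c → DecaysFromLeft φ θ e C c ∨ GrowsToRight φ θ e C c) {l : ℝ} (hl : 0 < l)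
    (hleft : DecaysFromLeft φ θ e C l) : nuZeroIndex φ ≤ θ - e := by
  obtain ⟨Q, hQ, hlr⟩ := hφ.exists_le_mul_of_decaysFromLeft_of_growsToRight (θ := θ) he hC
  obtain ⟨m, hm⟩ := pow_unbounded_of_one_lt (Q / l) one_lt_two
  rw [div_lt_iff₀ hl] at hm
  have hdecay (c : ℝ) (hc : 0 < c) (hcm : 2 ^ m * c ≤ 1) : DecaysFromLeft φ θ e C c := by
    refine (h c hc).resolve_right fun hright => hm.not_ge ?_
    calc 2 ^ m * l ≤ 2 ^ m * (Q * c) := by gcongr; exact hlr l c hl hc hleft hright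
      _ = Q * (2 ^ m * c) := by ring
      _ ≤ Q * 1 := by gcongr
      _ = Q := mul_one Q
  refine hφ.nuZeroIndex_le (C := 2 ^ m * C) (by positivity) fun n s hs hns => ?_
  obtain ⟨u, rfl⟩ : ∃ u, s = 2 ^ m * u := ⟨s / 2 ^ m, by field_simp⟩
  have hu : 0 < u := pos_of_mul_pos_right hs (by positivity)
  have hcomm : (2 : ℝ) ^ n * (2 ^ m * u) = 2 ^ m * (2 ^ n * u) := mul_left_comm _ _ _
  rw [hcomm] at hns ⊢
  have hnu := hdecay (2 ^ n * u) (by positivity) hns u hu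
    (le_mul_of_one_le_left hu.le (one_le_pow₀ one_le_two))
  rw [mul_div_cancel_right₀ _ hu.ne'] at hnu
  calc φ (2 ^ m * (2 ^ n * u)) ≤ 2 ^ m * φ (2 ^ n * u) := hφ.two_pow_mul_le m (by positivity)
    _ ≤ 2 ^ m * (C * (2 ^ n) ^ (θ - e) * φ u) := by gcongr
    _ ≤ 2 ^ m * (C * (2 ^ n) ^ (θ - e) * φ (2 ^ m * u)) := by
      gcongr
      exact hφ.le_two_pow_mul m hu
    _ = 2 ^ m * C * (2 ^ n) ^ (θ - e) * φ (2 ^ m * u) := by ring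

lemma le_muInftyIndex_of_exists_growsToRight (hφ : TameGrowth φ) (he : 0 < e) (hC : 0 < C)
    (h : ∀ c, 0 < c → DecaysFromLeft φ θ e C c ∨ GrowsToRight φ θ e C c) {r : ℝ} (hr : 0 < r)
    (hright : GrowsToRight φ θ e C r) : θ + e ≤ muInftyIndex φ := by
  obtain ⟨Q, -, hlr⟩ := hφ.exists_le_mul_of_decaysFromLeft_of_growsToRight (θ := θ) he hC
  obtain ⟨m, hm⟩ := pow_unbounded_of_one_lt (Q * r) one_lt_two
  have hgrowth (c : ℝ) (hc : 2 ^ m ≤ c) : GrowsToRight φ θ e C c := by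
    have hc₀ : 0 < c := lt_of_lt_of_le (by positivity) hc
    exact (h c hc₀).resolve_left fun hleft =>
      (hm.trans_le hc).not_ge (hlr c r hc₀ hr hleft hright)
  refine hφ.le_muInftyIndex (C := 2 ^ m * C) (by positivity) fun n s hs hns => ?_
  have hcomm : (2 : ℝ) ^ m * ((1 / 2) ^ n * s) = (1 / 2) ^ n * (2 ^ m * s) := mul_left_comm _ _ _
  have hgrow := hgrowth _ (hcomm ▸ le_mul_of_one_le_right (by positivity) hns) (2 ^ m * s)
    (mul_le_of_le_one_left (by positivity) (pow_le_one₀ (by norm_num) (by norm_num)))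
  rw [mul_div_cancel_right₀ _ (by positivity)] at hgrow
  calc φ ((1 / 2) ^ n * s) ≤ φ (2 ^ m * ((1 / 2) ^ n * s)) :=
        hφ.le_two_pow_mul m (by positivity)
    _ = φ ((1 / 2) ^ n * (2 ^ m * s)) := by rw [hcomm]
    _ ≤ C * ((1 / 2) ^ n) ^ (θ + e) * φ (2 ^ m * s) := hgrow
    _ ≤ C * ((1 / 2) ^ n) ^ (θ + e) * (2 ^ m * φ s) := by
      gcongr
      exact hφ.two_pow_mul_le m hs
    _ = 2 ^ m * C * ((1 / 2) ^ n) ^ (θ + e) * φ s := by ring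

lemma hasDampedPeaks_of_mem_Icc_muInftyIndex_nuIndex (hφ : TameGrowth φ)
    (hθ : θ ∈ Set.Icc (muInftyIndex φ) (nuIndex φ)) : HasDampedPeaks φ θ := by
  by_contra hpeaks
  obtain ⟨e, C, he, hC, h⟩ := exists_of_not_hasDampedPeaks hpeaks
  have hleft : ∀ c, 0 < c → DecaysFromLeft φ θ e C c := fun c hc =>
    (h c hc).resolve_right fun hright => by
      linarith [hθ.1, hφ.le_muInftyIndex_of_exists_growsToRight he hC h hc hright]
  linarith [hθ.2, hφ.nuIndex_le_of_decaysFromLeft hC hleft]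

lemma hasDampedPeaks_of_mem_Icc_muIndex_nuZeroIndex (hφ : TameGrowth φ)
    (hθ : θ ∈ Set.Icc (muIndex φ) (nuZeroIndex φ)) : HasDampedPeaks φ θ := by
  by_contra hpeaks
  obtain ⟨e, C, he, hC, h⟩ := exists_of_not_hasDampedPeaks hpeaks
  have hright : ∀ c, 0 < c → GrowsToRight φ θ e C c := fun c hc =>
    (h c hc).resolve_left fun hleft => by
      linarith [hθ.2, hφ.nuZeroIndex_le_of_exists_decaysFromLeft he hC h hc hleft]
  linarith [hθ.1, hφ.le_muIndex_of_growsToRight hC hright]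

end TameGrowth

section Recip

variable {p : ENNReal} {x y : ℝ}

lemma recip_anti (h : x ≤ y) : recip y ≤ recip x :=
  ENNReal.inv_le_inv.2 (ENNReal.ofReal_le_ofReal h)

lemma one_le_recip (hx : x ≤ 1) : 1 ≤ recip x := by
  rw [recip, ENNReal.one_le_inv]
  exact ENNReal.ofReal_le_one.2 hx

lemma inv_toReal_mem_Icc_of_mem_Icc_recip (hp : p ≠ 0) (hx : 0 ≤ x)
    (h : p ∈ Set.Icc (recip x) (recip y)) : p.toReal⁻¹ ∈ Set.Icc y x := by
  obtain ⟨hxp, hpy⟩ := h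
  rw [recip, ENNReal.inv_le_iff_inv_le] at hxp
  rw [recip, ENNReal.le_inv_iff_le_inv] at hpy
  rw [← ENNReal.toReal_inv]
  exact ⟨(ENNReal.ofReal_le_iff_le_toReal (ENNReal.inv_ne_top.2 hp)).1 hpy,
    ENNReal.toReal_le_of_le_ofReal hx hxp⟩

end Recip

end RISpaces

end

theorem mainTheorem7_general {E : Type*} [NormedAddCommGroup E] [NormedSpace ℝ E]
    {ι : E →ₗ[ℝ] RISpaces.S} (hι : RISpaces.IsRISpace ι) {φ : ℝ → ℝ}
    (hφ : φ = RISpaces.fundamentalFunction ι) (e : ℕ ≃ ℕ × ℕ) {p : ENNReal}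
    (hp : p ∈ Set.Icc (RISpaces.recip (RISpaces.nuIndex φ))
          (RISpaces.recip (RISpaces.muInftyIndex φ)) ∪
        Set.Icc (RISpaces.recip (RISpaces.nuZeroIndex φ)) (RISpaces.recip (RISpaces.muIndex φ))) :
    RISpaces.SymmetricallyBlockFinitelyRepresented ι p
      (fun i => RISpaces.dyadicChar (e i).1 (e i).2) := by
  subst hφ
  have hφ := hι.tameGrowth
  have hp_one : 1 ≤ p := hp.elim
    (fun hp => (RISpaces.one_le_recip hφ.nuIndex_le_one).trans hp.1)
    fun hp => (RISpaces.one_le_recip hφ.nuZeroIndex_le_one).trans hp.1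
  have : Fact (1 ≤ p) := ⟨hp_one⟩
  have hp_ne_zero : p ≠ 0 := (zero_lt_one.trans_le hp_one).ne'
  refine hι.symmetricallyBlockFinitelyRepresented (hp.elim (fun hp => ?_) fun hp => ?_) e
  · exact hφ.hasDampedPeaks_of_mem_Icc_muInftyIndex_nuIndex
      (RISpaces.inv_toReal_mem_Icc_of_mem_Icc_recip hp_ne_zero hφ.nuIndex_nonneg hp)
  · exact hφ.hasDampedPeaks_of_mem_Icc_muIndex_nuZeroIndex
      (RISpaces.inv_toReal_mem_Icc_of_mem_Icc_recip hp_ne_zero hφ.nuZeroIndex_nonneg hp)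

theorem mainTheorem7 {E : Type*} [NormedAddCommGroup E] [NormedSpace ℝ E]
    (ι : E →ₗ[ℝ] RISpaces.S) (hι : RISpaces.IsRISpace ι)
    (hsep : TopologicalSpace.SeparableSpace E)
    (φ : ℝ → ℝ) (hφ : φ = RISpaces.fundamentalFunction ι)
    (e : ℕ ≃ ℕ × ℕ) :
    (RISpaces.muInftyIndex φ ≤ RISpaces.nuZeroIndex φ →
      ∀ p : ENNReal,
        p ∈ Set.Icc (RISpaces.recip (RISpaces.nuIndex φ)) (RISpaces.recip (RISpaces.muIndex φ)) →
        RISpaces.SymmetricallyBlockFinitelyRepresented ι p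
          (fun i => RISpaces.dyadicChar (e i).1 (e i).2)) ∧
    (RISpaces.nuZeroIndex φ < RISpaces.muInftyIndex φ →
      ∀ p : ENNReal,
        p ∈ Set.Icc (RISpaces.recip (RISpaces.nuIndex φ))
              (RISpaces.recip (RISpaces.muInftyIndex φ)) ∪
            Set.Icc (RISpaces.recip (RISpaces.nuZeroIndex φ))
              (RISpaces.recip (RISpaces.muIndex φ)) →
        RISpaces.SymmetricallyBlockFinitelyRepresented ι p
          (fun i => RISpaces.dyadicChar (e i).1 (e i).2)) := by
  refine ⟨fun hle p hp => mainTheorem7_general hι hφ e ?_,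
    fun _ p hp => mainTheorem7_general hι hφ e hp⟩
  rcases le_total p (RISpaces.recip (RISpaces.muInftyIndex φ)) with hp' | hp'
  · exact Or.inl ⟨hp.1, hp'⟩
  · exact Or.inr ⟨(RISpaces.recip_anti hle).trans hp', hp.2⟩
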